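/- **Setting.** Let $S=\{\xi^1,\dots,\xi^n\}$ ($n\ge 1$) be a finite sample set, $\Theta\subseteq\mathbb R^q$ compact and convex, and $F(\theta)=\frac1n\sum_{s=1}^n F(\theta;\xi^s)$ with $F(\theta;\xi)=\varphi(f(\theta;\xi);\xi)$. Here $f=g-h$ takes values in $\mathbb R^d$, each component of $g(\cdot;\xi)$ and of $h(\cdot;\xi)$ is a maximum of $K\ge 1$ affine functions of $\theta$, and each $\varphi(\cdot;\xi):\mathbb R^d\to\mathbb R$ is B-differentiable (locally Lipschitz and directionally differentiable). For $\varepsilon\ge 0$ let $\mathcal I^\varepsilon(\theta')$ be the finite set of pairs $I=(I_1,I_2)$ of index mappings that assign to each component and each $\xi\in S$ an index of a piece of $g$, respectively $h$, whose value at $\theta'$ is within $\varepsilon$ of the maximum. Let $\widehat F(\theta;\theta',\xi,I)$ be a surrogate family such that for all $\xi\in S$, $\theta'\in\Theta$: (a) for all $\varepsilon\ge 0$ and $I\in\mathcal I^\varepsilon(\theta')$, $\widehat F(\cdot;\theta',\xi,I)$ is convex on $\Theta$ and $\widehat F(\cdot;\theta',\xi,I)\ge F(\cdot;\xi)$ on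 $\Theta$; (b) $\widehat F(\theta';\theta',\xi,I)=F(\theta';\xi)$ for $I\in\mathcal I^0(\theta')$; (c) $\widehat F(\cdot;\cdot,\xi,I)$ is continuous on $\Theta\times\Theta$ for each fixed index mapping pair $I$; (d) for all $\varepsilon\ge 0$, $\min_{I\in\mathcal I^\varepsilon(\theta')}\widehat F(\cdot;\theta',\xi,I)$ is directionally differentiable on $\Theta$ and at $\theta'$ has the same directional derivatives as $F(\cdot;\xi)$. **Algorithm.** Given $\theta^0\in\Theta$, $T\ge 1$, $\varepsilon,\eta\ge 0$ and positive integers $N_\nu$: for $\nu=0,\dots,T-1$ draw $\xi_\nu^1,\dots,\xi_\nu^{N_\nu}$ independently and uniformly from $S$ and, independently of them, $I_\nu$ uniformly from $\mathcal I^\varepsilon(\theta^\nu)$, all given the past; let $\theta^{\nu+\frac12}$ be a minimizer over $\Theta$ of $\widehat F_{N_\nu}(\theta;\theta^\nu,I_\nu)+\frac\eta2\|\theta-\theta^\nu\|^2$, where $\widehat F_{N_\nu}$ and $F_{N_\nu}$ are the averages of $\widehat F$ and $F$ over the drawn samples; set $\theta^{\nu+1}=\theta^{\nu+\frac12}$ if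 $\widehat F_{N_\nu}(\theta^{\nu+\frac12};\theta^\nu,I_\nu)+\frac\eta2\|\theta^{\nu+\frac12}-\theta^\nu\|^2\le F_{N_\nu}(\theta^\nu)$, and $\theta^{\nu+1}=\theta^\nu$ otherwise. The output $\widetilde\theta^{\,T}$ is sampled uniformly from $\theta^0,\dots,\theta^{T-1}$, independently of these iterates. **Residual.** For $\rho>0$ let $\widehat F(\theta;\theta',I)=\frac1n\sum_s\widehat F(\theta;\theta',\xi^s,I)$, and let $P_I^\rho(\theta')$ be the minimizer over $\Theta$ of $\widehat F(\theta;\theta',I)+\frac\rho2\|\theta-\theta'\|^2$ if the minimum value is at most $F(\theta')$, and $\theta'$ otherwise. Put $\bar r^{\varepsilon,\rho}(\theta')=\frac1{|\mathcal I^\varepsilon(\theta')|}\sum_{I\in\mathcal I^\varepsilon(\theta')}\|\theta'-P_I^\rho(\theta')\|$. **Proposition 4.** (1) There is a constant $C_1>0$, depending only on the problem and the surrogate family, such that for all $\varepsilon,\eta\ge 0$, all sequences with $N_\nu\ge 2$ for every $\nu$, all $T\ge 1$, all $\theta^0\in\Theta$ and all $\rho>\eta$, every output $\widetilde\theta^{\,T}$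 of the algorithm satisfies that $\bar r^{\varepsilon,\rho}(\widetilde\theta^{\,T})$ is integrable and $$\big(\mathbb E[\bar r^{\varepsilon,\rho}(\widetilde\theta^{\,T})]\big)^2\le\frac{F(\theta^0)-\min_{\theta\in\Theta}F(\theta)+C_1\sum_{\nu=0}^{T-1}\sqrt{\log N_\nu/N_\nu}}{\frac{\rho-\eta}2\,T}.$$ If $\{N_\nu\}$ is strictly increasing with $N_0\ge 1$ (so $N_0=1$ is allowed), the same holds for all such $\varepsilon,\eta,T,\theta^0,\rho$ with a constant $C_1>0$ that may in addition depend on the sequence $\{N_\nu\}$. (2) For $\varepsilon=0$ and every $\eta>0$ there is a constant $C_2>0$, depending only on the problem, the surrogate family and $\eta$, such that for all sequences with $N_\nu\ge 1$, all $T\ge 1$, all $\theta^0\in\Theta$ and all $\rho>\eta$, $\bar r^{0,\rho}(\widetilde\theta^{\,T})$ is integrable and $$\big(\mathbb E[\bar r^{0,\rho}(\widetilde\theta^{\,T})]\big)^2\le\frac{F(\theta^0)-\min_{\theta\in\Theta}F(\theta)+C_2\sum_{\nu=0}^{T-1}1/N_\nu}{\frac{\rho-\eta}2\,T}.$$ 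-/

import Mathlib

open MeasureTheory ProbabilityTheory Filter Topology
open scoped ENNReal

universe u

/-! ### Directional derivatives and Bouligand differentiability -/

/-- `L` is the (one-sided) directional derivative `φ'(x; v)`. -/
def HasDirDeriv {V : Type*} [AddCommGroup V] [Module ℝ V]
    (φ : V → ℝ) (x v : V) (L : ℝ) : Prop :=
  Tendsto (fun τ : ℝ => (φ (x + τ • v) - φ x) / τ) (𝓝[>] 0) (𝓝 L)

/-- `φ` has a directional derivative at every point of `s` in every direction. -/
def DirDifferentiableOn {V : Type*} [AddCommGroup V] [Module ℝ V]
    (φ : V → ℝ) (s : Set V) : Prop :=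
  ∀ x ∈ s, ∀ v : V, ∃ L : ℝ, HasDirDeriv φ x v L

/-- Bouligand differentiability on the whole space. -/
def BDifferentiable {V : Type*} [NormedAddCommGroup V] [NormedSpace ℝ V] (φ : V → ℝ) : Prop :=
  LocallyLipschitz φ ∧ DirDifferentiableOn φ Set.univ

/-! ### The problem -/

/-- Data of the empirical risk minimization problem
`min_{θ ∈ Θ} F(θ) = (1/n) ∑ₛ φ(f(θ; ξˢ); ξˢ)`, where the sample set is `S = {ξ¹, …, ξⁿ}`
(a sample is represented by its index `s : Fin n`), `Θ ⊆ ℝ^q`, `f = g - h` takes values in `ℝ^d`,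
and each component of `g`, `h` is a maximum of `K` affine functions of the parameter `θ`. -/
structure ERMProblem (n d K q : ℕ) where
  /-- the pieces of `g`: sample, component, piece -/
  gPiece : Fin n → Fin d → Fin K → (EuclideanSpace ℝ (Fin q) →ᵃ[ℝ] ℝ)
  /-- the pieces of `h`: sample, component, piece -/
  hPiece : Fin n → Fin d → Fin K → (EuclideanSpace ℝ (Fin q) →ᵃ[ℝ] ℝ)
  /-- the outer function `φ(·; ξ)` -/
  φ : Fin n → EuclideanSpace ℝ (Fin d) → ℝ
  /-- the feasible set -/
  Θ : Set (EuclideanSpace ℝ (Fin q))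

/-- A pair of index mappings `(I₁, I₂)`; for every component and every sample, `I₁` picks a piece
of `g` and `I₂` picks a piece of `h`. -/
abbrev IndexMap (n d K : ℕ) : Type :=
  (Fin d → Fin n → Fin K) × (Fin d → Fin n → Fin K)

/-- A family of surrogates `F̂(θ; θ', ξ, I)`; the arguments come in this order. -/
abbrev SurrogateFamily (n d K q : ℕ) : Type :=
  EuclideanSpace ℝ (Fin q) → EuclideanSpace ℝ (Fin q) → Fin n → IndexMap n d K → ℝ

namespace ERMProblem

variable {n d K q : ℕ}

/-- `g(θ; ξ)`, componentwise. -/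
noncomputable def g (P : ERMProblem n d K q) (θ : EuclideanSpace ℝ (Fin q)) (s : Fin n)
    (ι : Fin d) : ℝ :=
  ⨆ k : Fin K, P.gPiece s ι k θ

/-- `h(θ; ξ)`, componentwise. -/
noncomputable def h (P : ERMProblem n d K q) (θ : EuclideanSpace ℝ (Fin q)) (s : Fin n)
    (ι : Fin d) : ℝ :=
  ⨆ k : Fin K, P.hPiece s ι k θ

/-- The piecewise affine decision `f(θ; ξ) = g(θ; ξ) - h(θ; ξ) ∈ ℝ^d`. -/
noncomputable def f (P : ERMProblem n d K q) (θ : EuclideanSpace ℝ (Fin q)) (s : Fin n) :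
    EuclideanSpace ℝ (Fin d) :=
  WithLp.toLp 2 fun ι => P.g θ s ι - P.h θ s ι

/-- `F(θ; ξ) = φ(f(θ; ξ); ξ)`. -/
noncomputable def Fs (P : ERMProblem n d K q) (θ : EuclideanSpace ℝ (Fin q)) (s : Fin n) : ℝ :=
  P.φ s (P.f θ s)

/-- `F(θ)`, the average of `F(θ; ξ)` over `S`. -/
noncomputable def F (P : ERMProblem n d K q) (θ : EuclideanSpace ℝ (Fin q)) : ℝ :=
  (1 / (n : ℝ)) * ∑ s : Fin n, P.Fs θ s

/-- `F_N(θ)`, the average of `F(θ; ξ)` over a drawn sample `z` of size `N`. -/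
noncomputable def FN (P : ERMProblem n d K q) {N : ℕ} (z : Fin N → Fin n)
    (θ : EuclideanSpace ℝ (Fin q)) : ℝ :=
  (1 / (N : ℝ)) * ∑ i : Fin N, P.Fs θ (z i)

open Classical in
/-- The set `I^ε(θ')` of pairs of `ε`-active index mappings at `θ'`. -/
noncomputable def activeMaps (P : ERMProblem n d K q) (ε : ℝ) (θ' : EuclideanSpace ℝ (Fin q)) :
    Finset (IndexMap n d K) :=
  Finset.univ.filter fun I =>
    (∀ (ι : Fin d) (s : Fin n), P.g θ' s ι - ε ≤ P.gPiece s ι (I.1 ι s) θ') ∧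
    (∀ (ι : Fin d) (s : Fin n), P.h θ' s ι - ε ≤ P.hPiece s ι (I.2 ι s) θ')

/-- The minimum surrogate `F̂^ε_min(θ; θ', ξ) = min_{I ∈ I^ε(θ')} F̂(θ; θ', ξ, I)`. -/
noncomputable def Fmin (P : ERMProblem n d K q) (Fhat : SurrogateFamily n d K q) (ε : ℝ)
    (θ θ' : EuclideanSpace ℝ (Fin q)) (s : Fin n) : ℝ :=
  sInf ((fun I => Fhat θ θ' s I) '' (P.activeMaps ε θ' : Set (IndexMap n d K)))

/-- The standing assumption on the surrogate family. -/
structure IsSurrogateFamily (P : ERMProblem n d K q) (Fhat : SurrogateFamily n d K q) : Prop where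
  /-- majorization, for active index mappings of every tolerance -/
  majorizes : ∀ ε : ℝ, 0 ≤ ε → ∀ θ' ∈ P.Θ, ∀ (s : Fin n), ∀ I ∈ P.activeMaps ε θ',
    ∀ θ ∈ P.Θ, P.Fs θ s ≤ Fhat θ θ' s I
  /-- convexity, for active index mappings of every tolerance -/
  convex : ∀ ε : ℝ, 0 ≤ ε → ∀ θ' ∈ P.Θ, ∀ (s : Fin n), ∀ I ∈ P.activeMaps ε θ',
    ConvexOn ℝ P.Θ fun θ => Fhat θ θ' s I
  /-- touching, for exactly active index mappings -/
  touches : ∀ θ' ∈ P.Θ, ∀ (s : Fin n), ∀ I ∈ P.activeMaps 0 θ', Fhat θ' θ' s I = P.Fs θ' s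
  /-- joint continuity for a fixed index mapping -/
  continuous : ∀ (s : Fin n) (I : IndexMap n d K),
    ContinuousOn
      (fun p : EuclideanSpace ℝ (Fin q) × EuclideanSpace ℝ (Fin q) => Fhat p.1 p.2 s I)
      (P.Θ ×ˢ P.Θ)
  /-- the minimum surrogate is directionally differentiable on `Θ` -/
  min_dirDifferentiable : ∀ ε : ℝ, 0 ≤ ε → ∀ θ' ∈ P.Θ, ∀ (s : Fin n),
    DirDifferentiableOn (fun θ => P.Fmin Fhat ε θ θ' s) P.Θ
  /-- and has the directional derivatives of `F(·; ξ)` at the reference point -/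
  min_dirDeriv : ∀ ε : ℝ, 0 ≤ ε → ∀ θ' ∈ P.Θ, ∀ (s : Fin n) (v : EuclideanSpace ℝ (Fin q)),
    ∃ L : ℝ, HasDirDeriv (fun θ => P.Fmin Fhat ε θ θ' s) θ' v L ∧
      HasDirDeriv (fun θ => P.Fs θ s) θ' v L

end ERMProblem

namespace SurrogateFamily

variable {n d K q : ℕ}

/-- `F̂(θ; θ', I)`, the average of the surrogates over `S`. -/
noncomputable def avg (Fhat : SurrogateFamily n d K q) (θ θ' : EuclideanSpace ℝ (Fin q))
    (I : IndexMap n d K) : ℝ :=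
  (1 / (n : ℝ)) * ∑ s : Fin n, Fhat θ θ' s I

/-- `F̂_N(θ; θ', I)`, the average of the surrogates over a drawn sample `z` of size `N`. -/
noncomputable def avgN (Fhat : SurrogateFamily n d K q) {N : ℕ} (z : Fin N → Fin n)
    (θ θ' : EuclideanSpace ℝ (Fin q)) (I : IndexMap n d K) : ℝ :=
  (1 / (N : ℝ)) * ∑ i : Fin N, Fhat θ θ' (z i) I

end SurrogateFamily

namespace ERMProblem

variable {n d K q : ℕ}

/-! ### The averaged residual -/

/-- The proximal objective `θ ↦ F̂(θ; θ', I) + (ρ/2) ‖θ - θ'‖²`. -/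
noncomputable def proxObj (Fhat : SurrogateFamily n d K q) (ρ : ℝ)
    (θ' : EuclideanSpace ℝ (Fin q)) (I : IndexMap n d K) (θ : EuclideanSpace ℝ (Fin q)) : ℝ :=
  SurrogateFamily.avg Fhat θ θ' I + ρ / 2 * ‖θ - θ'‖ ^ 2

/-- The proximal point, the minimizer over `Θ` of the proximal objective (it exists and is unique
for `ρ > 0` and convex surrogates that are continuous on the nonempty compact set `Θ`). -/
noncomputable def prox (P : ERMProblem n d K q) (Fhat : SurrogateFamily n d K q) (ρ : ℝ)
    (θ' : EuclideanSpace ℝ (Fin q)) (I : IndexMap n d K) : EuclideanSpace ℝ (Fin q) :=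
  Classical.epsilon fun θ => θ ∈ P.Θ ∧ IsMinOn (proxObj Fhat ρ θ' I) P.Θ θ

open Classical in
/-- The map `P^ρ_I(θ')`: the proximal point if the minimum of the proximal objective is at most
`F(θ')`, and `θ'` otherwise. -/
noncomputable def proxMap (P : ERMProblem n d K q) (Fhat : SurrogateFamily n d K q) (ρ : ℝ)
    (I : IndexMap n d K) (θ' : EuclideanSpace ℝ (Fin q)) : EuclideanSpace ℝ (Fin q) :=
  if proxObj Fhat ρ θ' I (P.prox Fhat ρ θ' I) ≤ P.F θ' then P.prox Fhat ρ θ' I else θ'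

/-- The averaged residual `r̄^{ε,ρ}(θ')`. -/
noncomputable def rbar (P : ERMProblem n d K q) (Fhat : SurrogateFamily n d K q) (ε ρ : ℝ)
    (θ' : EuclideanSpace ℝ (Fin q)) : ℝ :=
  (1 / ((P.activeMaps ε θ').card : ℝ)) *
    ∑ I ∈ P.activeMaps ε θ', ‖θ' - P.proxMap Fhat ρ I θ'‖

end ERMProblem

/-! ### The algorithm -/

open Classical in
/-- A run, on the probability space `(Ω, μ)`, of the enhanced stochastic majorization-minimization
algorithm with `T` iterations, initial point `θ₀`, parameters `ε`, `η` and sample sizes `N ν`. -/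
structure SMMRun {n d K q : ℕ} (P : ERMProblem n d K q) (Fhat : SurrogateFamily n d K q)
    (ε η : ℝ) (N : ℕ → ℕ) (T : ℕ) (θ₀ : EuclideanSpace ℝ (Fin q))
    {Ω : Type*} [MeasurableSpace Ω] (μ : Measure Ω) where
  /-- `𝓕 ν` is the information available at the beginning of iteration `ν`. -/
  𝓕 : Filtration ℕ ‹MeasurableSpace Ω›
  /-- the samples `ξ_ν^1, …, ξ_ν^{N_ν}` drawn in iteration `ν` -/
  ξ : (ν : ℕ) → Ω → (Fin (N ν) → Fin n)
  /-- the index mapping selected in iteration `ν` -/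
  I : ℕ → Ω → IndexMap n d K
  /-- the iterates -/
  θ : ℕ → Ω → EuclideanSpace ℝ (Fin q)
  /-- the candidate points `θ^{ν + 1/2}` -/
  θhalf : ℕ → Ω → EuclideanSpace ℝ (Fin q)
  /-- the iteration whose iterate is returned -/
  τ : Ω → Fin T
  measurable_θ : ∀ ν ≤ T, Measurable[𝓕 ν] (θ ν)
  measurable_ξ : ∀ ν < T, Measurable[𝓕 (ν + 1)] (ξ ν)
  measurable_I : ∀ ν < T, Measurable[𝓕 (ν + 1)] (I ν)
  measurable_τ : Measurable τ
  initial : ∀ ω, θ 0 ω = θ₀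
  /-- Given the past, the index mapping is uniform on `I^ε(θ^ν)`, the samples are independent and
  uniform on `S`, and the two draws are independent of each other. -/
  draw : ∀ ν < T, ∀ A : Set Ω, MeasurableSet[𝓕 ν] A →
    ∀ (J : IndexMap n d K) (z : Fin (N ν) → Fin n),
      μ (A ∩ {ω | I ν ω = J ∧ ξ ν ω = z}) =
        ∫⁻ ω in A,
          (if J ∈ P.activeMaps ε (θ ν ω) then ((P.activeMaps ε (θ ν ω)).card : ℝ≥0∞)⁻¹ else 0) *
            ((n : ℝ≥0∞)⁻¹) ^ N ν ∂μ
  /-- The candidate point solves the sampled proximal subproblem. -/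
  candidate : ∀ ν < T, ∀ ω, θhalf ν ω ∈ P.Θ ∧
    IsMinOn (fun θ' => SurrogateFamily.avgN Fhat (ξ ν ω) θ' (θ ν ω) (I ν ω)
      + η / 2 * ‖θ' - θ ν ω‖ ^ 2) P.Θ (θhalf ν ω)
  /-- The candidate point is accepted if it gives sufficient descent. -/
  update : ∀ ν < T, ∀ ω, θ (ν + 1) ω =
    if SurrogateFamily.avgN Fhat (ξ ν ω) (θhalf ν ω) (θ ν ω) (I ν ω)
        + η / 2 * ‖θhalf ν ω - θ ν ω‖ ^ 2 ≤ P.FN (ξ ν ω) (θ ν ω)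
    then θhalf ν ω else θ ν ω
  /-- The returned iterate is chosen uniformly … -/
  output_uniform : ∀ t : Fin T, μ {ω | τ ω = t} = (T : ℝ≥0∞)⁻¹
  /-- … and independently of the iterates. -/
  output_indep : IndepFun τ (fun ω (t : Fin T) => θ t ω) μ

/-- The output `θ̃^T` of a run. -/
def SMMRun.output {n d K q : ℕ} {P : ERMProblem n d K q} {Fhat : SurrogateFamily n d K q}
    {ε η : ℝ} {N : ℕ → ℕ} {T : ℕ} {θ₀ : EuclideanSpace ℝ (Fin q)}
    {Ω : Type*} [MeasurableSpace Ω] {μ : Measure Ω} (R : SMMRun P Fhat ε η N T θ₀ μ) (ω : Ω) :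
    EuclideanSpace ℝ (Fin q) :=
  R.θ (R.τ ω) ω

open scoped BigOperators NNReal

/-!
Let `x` be the current iterate. The candidate minimizes the sampled proximal model with parameter
`η`, so its sampled objective is at most the value of that model at `prox`, the proximal point of
the full model with parameter `ρ`. Since `prox` depends only on `x` and the index mapping, averaging
over the sample turns this value into the full model at `prox`: up to the error of replacing `F_N`
by `F` at the two iterates, one iteration decreases `F` in expectation by `(ρ - η) / 2` times the
mean squared residual of `x`. Telescoping over the iterations and Jensen's inequality turn this into
a bound for the residual of the output.

The sampling error is at most `Δ L ‖y - x‖`, where `y` is the next iterate, `L` is a Lipschitz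
constant of all `F(·; ξ)` on `Θ`, and `Δ` is the total deviation of the empirical frequencies from
the uniform ones, with `𝔼 Δ ≤ √(n / N)` and `𝔼 Δ² ≤ n / N`. Bounding `‖y - x‖` by the diameter of
`Θ` gives errors of order `1 / √N`; if `η > 0`, then Young's inequality absorbs `‖y - x‖` into the
proximal term `η / 2 * ‖y - x‖ ^ 2`, which leaves errors of order `1 / N`.

Moreover `1 / √N` is at most a multiple of `√(log N / N)` if `N ≥ 2`. If `N₀ = 1`, the bound has no
term for the first iteration; it is then covered by the term of the second one, and if there is no
second iteration, `F θ₀ - min F` alone bounds the residual of `θ₀`.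
-/

/-! ### Sampling with replacement -/

section Sampling

variable {α ι : Type*} [Fintype α] [Fintype ι]

/-- The error of estimating the mean of `g` from the sample `z`. -/
noncomputable def sampleDev (z : ι → α) (g : α → ℝ) : ℝ :=
  𝔼 a, g a - 𝔼 i, g (z i)

/-- The sum of the deviations of the empirical frequencies of `z` from the uniform ones; it bounds
the sampling error of all functions at once. -/
noncomputable def totalDev [DecidableEq α] (z : ι → α) : ℝ :=
  ∑ a, |sampleDev z (Pi.single a 1)|

theorem totalDev_nonneg [DecidableEq α] (z : ι → α) : 0 ≤ totalDev z :=
  Finset.sum_nonneg fun _ _ => abs_nonneg _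

theorem sampleDev_sub (z : ι → α) (f g : α → ℝ) :
    sampleDev z f - sampleDev z g = sampleDev z (f - g) := by
  simp only [sampleDev, Pi.sub_apply, Finset.expect_sub_distrib]
  ring

theorem sampleDev_eq_sum_single [DecidableEq α] (z : ι → α) (g : α → ℝ) :
    sampleDev z g = ∑ a, g a * sampleDev z (Pi.single a 1) := by
  have h (b : α) : g b = ∑ a, g a * (Pi.single a 1 : α → ℝ) b := by
    simp [Pi.single_apply]
  rw [sampleDev, Finset.expect_congr rfl fun b _ => h b,
    Finset.expect_congr rfl fun i _ => h (z i), Finset.expect_sum_comm, Finset.expect_sum_comm,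
    ← Finset.sum_sub_distrib]
  simp only [sampleDev, mul_sub, Finset.mul_expect]

theorem sampleDev_le_totalDev_mul [DecidableEq α] (z : ι → α) {g : α → ℝ} {c : ℝ}
    (hg : ∀ a, |g a| ≤ c) : sampleDev z g ≤ totalDev z * c := by
  rw [sampleDev_eq_sum_single, totalDev, Finset.sum_mul]
  refine Finset.sum_le_sum fun a _ => (le_abs_self _).trans ?_
  rw [abs_mul, mul_comm]
  gcongr
  exact hg a

variable [Nonempty α] [DecidableEq ι]

theorem expect_pi_eval (g : α → ℝ) (i : ι) : 𝔼 z : ι → α, g (z i) = 𝔼 a, g a := by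
  rw [Fintype.expect_equiv (Equiv.funSplitAt i α) (fun z => g (z i)) (fun p => g p.1)
      fun _ => rfl, ← Finset.univ_product_univ, Finset.expect_product]
  simp only [Fintype.expect_const]

theorem expect_pi_mul_of_ne (f g : α → ℝ) {i j : ι} (hij : i ≠ j) :
    𝔼 z : ι → α, f (z i) * g (z j) = (𝔼 a, f a) * 𝔼 a, g a := by
  rw [Fintype.expect_equiv (Equiv.funSplitAt i α) (fun z => f (z i) * g (z j))
      (fun p => f p.1 * g (p.2 ⟨j, hij.symm⟩)) fun _ => rfl,
    ← Finset.univ_product_univ, Finset.expect_product]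
  simp only [← Finset.mul_expect, ← Finset.expect_mul, expect_pi_eval]

variable [Nonempty ι]

theorem expect_expect_pi_eval (g : α → ℝ) : 𝔼 z : ι → α, 𝔼 i, g (z i) = 𝔼 a, g a := by
  rw [Finset.expect_comm]
  simp only [expect_pi_eval, Fintype.expect_const]

theorem expect_sub_expect_sq_le (g : α → ℝ) : 𝔼 a, (g a - 𝔼 b, g b) ^ 2 ≤ 𝔼 a, g a ^ 2 := by
  simp only [sub_sq, Finset.expect_add_distrib, Finset.expect_sub_distrib, mul_assoc,
    ← Finset.mul_expect, ← Finset.expect_mul, Fintype.expect_const]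
  linarith [sq_nonneg (𝔼 b, g b)]

theorem expect_sampleDev_sq_le (g : α → ℝ) :
    𝔼 z : ι → α, sampleDev z g ^ 2 ≤ (𝔼 a, g a ^ 2) / Fintype.card ι := by
  set c : α → ℝ := fun a => g a - 𝔼 b, g b with hc
  have hcentered : 𝔼 a, c a = 0 := by
    simp only [hc, Finset.expect_sub_distrib, Fintype.expect_const, sub_self]
  have hdev (z : ι → α) : sampleDev z g ^ 2 = 𝔼 i, 𝔼 j, c (z i) * c (z j) := by
    simp only [hc, ← Finset.expect_mul_expect, Finset.expect_sub_distrib, Fintype.expect_const,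
      sampleDev]
    ring
  have hcov (i j : ι) : 𝔼 z : ι → α, c (z i) * c (z j) = if i = j then 𝔼 a, c a ^ 2 else 0 := by
    split_ifs with hij
    · simp only [hij, ← sq]
      exact expect_pi_eval (fun a => c a ^ 2) j
    · rw [expect_pi_mul_of_ne c c hij, hcentered, zero_mul]
  calc 𝔼 z : ι → α, sampleDev z g ^ 2
      = 𝔼 i : ι, 𝔼 j, 𝔼 z : ι → α, c (z i) * c (z j) := by
        simp only [hdev]
        rw [Finset.expect_comm]
        exact Finset.expect_congr rfl fun i _ => Finset.expect_comm ..
    _ = (𝔼 a, c a ^ 2) / Fintype.card ι := by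
        simp only [hcov, Fintype.expect_ite_eq, Fintype.expect_const]
        rw [NNRat.smul_def, NNRat.cast_inv, NNRat.cast_natCast, inv_mul_eq_div]
    _ ≤ (𝔼 a, g a ^ 2) / Fintype.card ι := by
        exact div_le_div_of_nonneg_right (expect_sub_expect_sq_le g) (Nat.cast_nonneg _)

variable [DecidableEq α]

theorem expect_totalDev_sq_le :
    𝔼 z : ι → α, totalDev z ^ 2 ≤ (Fintype.card α : ℝ) / Fintype.card ι := by
  have hsingle (a : α) : 𝔼 b, (Pi.single a 1 : α → ℝ) b ^ 2 = 1 / (Fintype.card α : ℝ) := by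
    simp [Pi.single_apply]
  calc 𝔼 z : ι → α, totalDev z ^ 2
      ≤ 𝔼 z : ι → α, (Fintype.card α : ℝ) * ∑ a, sampleDev z (Pi.single a 1) ^ 2 := by
        refine Finset.expect_le_expect fun z _ => ?_
        simpa only [totalDev, sq_abs, Finset.card_univ] using
          sq_sum_le_card_mul_sum_sq (s := Finset.univ)
            (f := fun a => |sampleDev z (Pi.single a 1)|)
    _ = Fintype.card α * ∑ a, 𝔼 z : ι → α, sampleDev z (Pi.single a 1) ^ 2 := by
        rw [← Finset.mul_expect, Finset.expect_sum_comm]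
    _ ≤ Fintype.card α * ∑ _a : α, 1 / (Fintype.card α : ℝ) / Fintype.card ι := by
        gcongr with a
        exact (expect_sampleDev_sq_le _).trans_eq (by rw [hsingle])
    _ = (Fintype.card α : ℝ) / Fintype.card ι := by
        rw [Finset.sum_const, Finset.card_univ, nsmul_eq_mul]
        field_simp

theorem sq_expect_le {κ : Type*} (s : Finset κ) (f : κ → ℝ) :
    (𝔼 i ∈ s, f i) ^ 2 ≤ 𝔼 i ∈ s, f i ^ 2 := by
  simpa only [Finset.expect_eq_sum_div_card] using
    sum_div_card_sq_le_sum_sq_div_card (s := s) (f := f)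

theorem expect_totalDev_le :
    𝔼 z : ι → α, totalDev z ≤ √(Fintype.card α / Fintype.card ι) :=
  Real.le_sqrt_of_sq_le ((sq_expect_le _ _).trans expect_totalDev_sq_le)

end Sampling

/-! ### Conditional laws and integrability -/

section CondLaw

variable {Ω X κ : Type*} [MeasurableSpace Ω] [MeasurableSpace X] {μ : Measure Ω}

theorem integrable_map_restrict {Z : Ω → X} (hZ : Measurable Z) {f : X → ℝ}
    (hf : Integrable f (μ.map Z)) (E : Set Ω) : Integrable f ((μ.restrict E).map Z) :=
  hf.mono_measure (Measure.map_mono Measure.restrict_le_self hZ)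

theorem integrable_comp_of_finite {Y : Ω → κ} {Z : Ω → X} [Finite κ] [MeasurableSpace κ]
    [MeasurableSingletonClass κ] (hY : Measurable Y) (hZ : Measurable Z) {ψ : κ → X → ℝ}
    (hψ : ∀ y, Integrable (ψ y) (μ.map Z)) : Integrable (fun ω => ψ (Y ω) (Z ω)) μ := by
  rw [← integrableOn_univ, ← Set.preimage_univ (f := Y), ← Set.iUnion_of_singleton κ,
    Set.preimage_iUnion, integrableOn_finite_iUnion]
  intro y
  refine ((hψ y).comp_measurable hZ).integrableOn.congr_fun (fun ω hω => ?_)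
    (hY (measurableSet_singleton y))
  exact congrArg (ψ · (Z ω)) (Set.mem_singleton_iff.1 hω).symm

/-- The weights `w y x` form a version of the conditional law of the discrete random variable `Y`
given `Z = x`. -/
def HasCondLaw (Y : Ω → κ) (Z : Ω → X) (w : κ → X → ℝ≥0) (μ : Measure Ω) : Prop :=
  ∀ y, ∀ B, MeasurableSet B → μ (Z ⁻¹' B ∩ Y ⁻¹' {y}) = ∫⁻ ω in Z ⁻¹' B, w y (Z ω) ∂μ

namespace HasCondLaw

variable {Y : Ω → κ} {Z : Ω → X} {w : κ → X → ℝ≥0}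

theorem map_restrict (h : HasCondLaw Y Z w μ) (hZ : Measurable Z) (hw : ∀ y, Measurable (w y))
    (y : κ) :
    (μ.restrict (Y ⁻¹' {y})).map Z = (μ.map Z).withDensity fun x => w y x := by
  ext B hB
  rw [Measure.map_apply hZ hB, Measure.restrict_apply (hZ hB), h y B hB, withDensity_apply _ hB,
    setLIntegral_map hB (hw y).coe_nnreal_ennreal hZ]

theorem integral_comp (h : HasCondLaw Y Z w μ) (hZ : Measurable Z)
    (hw : ∀ y, Measurable (w y)) [Fintype κ] [MeasurableSpace κ] [MeasurableSingletonClass κ]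
    (hY : Measurable Y) {ψ : κ → X → ℝ} (hψ : ∀ y, Integrable (ψ y) (μ.map Z)) :
    ∫ ω, ψ (Y ω) (Z ω) ∂μ = ∫ x, ∑ y, w y x • ψ y x ∂μ.map Z := by
  have hfiber (y : κ) :
      ∫ ω in Y ⁻¹' {y}, ψ (Y ω) (Z ω) ∂μ = ∫ x, w y x • ψ y x ∂μ.map Z := by
    rw [← integral_withDensity_eq_integral_smul (hw y), ← h.map_restrict hZ hw,
      integral_map hZ.aemeasurable (integrable_map_restrict hZ (hψ y) _).aestronglyMeasurable]
    refine setIntegral_congr_fun (hY (measurableSet_singleton y)) fun ω hω => ?_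
    exact congrArg (ψ · (Z ω)) (Set.mem_singleton_iff.1 hω)
  have hweighted (y : κ) : Integrable (fun x => w y x • ψ y x) (μ.map Z) := by
    rw [← integrable_withDensity_iff_integrable_smul (hw y), ← h.map_restrict hZ hw]
    exact integrable_map_restrict hZ (hψ y) _
  rw [integral_finsetSum _ fun y _ => hweighted y, ← setIntegral_univ,
    ← Set.preimage_univ (f := Y), ← Set.iUnion_of_singleton κ, Set.preimage_iUnion,
    integral_iUnion_fintype (fun y => hY (measurableSet_singleton y))
      (fun y y' hy => (Set.disjoint_singleton.2 hy).preimage Y)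
      fun y => (integrable_comp_of_finite hY hZ hψ).integrableOn]
  exact Finset.sum_congr rfl fun y _ => hfiber y

end HasCondLaw

variable {m : Measure X}

theorem integrable_expect [Finite κ] {A : X → Finset κ} (hA : Measurable A)
    {f : κ → X → ℝ} (hf : ∀ j, Integrable (f j) m) :
    Integrable (fun x => 𝔼 j ∈ A x, f j x) m := by
  classical
  have := Fintype.ofFinite κ
  have hsum : (fun x => 𝔼 j ∈ A x, f j x) =
      fun x => ∑ s : Finset κ, (A ⁻¹' {s}).indicator (fun x => 𝔼 j ∈ s, f j x) x := by
    ext x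
    simp [Set.indicator_apply]
  rw [hsum]
  refine integrable_finsetSum _ fun s _ => Integrable.indicator ?_ (hA (measurableSet_singleton s))
  simp only [Finset.expect_eq_sum_div_card]
  exact (integrable_finsetSum _ fun j _ => hf j).div_const _

theorem integrable_ite_le [TopologicalSpace X] [CompactSpace X] [OpensMeasurableSpace X]
    [IsFiniteMeasure m] {p q a b : X → ℝ} (hp : Continuous p) (hq : Continuous q)
    (ha : Continuous a) (hb : Continuous b) :
    Integrable (fun x => open Classical in if p x ≤ q x then a x else b x) m := by
  classical
  have hint {f : X → ℝ} (hf : Continuous f) : Integrable f m :=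
    hf.integrable_of_hasCompactSupport (HasCompactSupport.of_compactSpace f)
  exact Integrable.piecewise (isClosed_le hp hq).measurableSet (hint ha).integrableOn
    (hint hb).integrableOn

theorem sq_integral_le [IsProbabilityMeasure m] {f g : X → ℝ} (hf : Integrable f m)
    (hg : Integrable g m) (hfg : ∀ x, f x ^ 2 ≤ g x) : (∫ x, f x ∂m) ^ 2 ≤ ∫ x, g x ∂m := by
  have hsq : Integrable (fun x => f x ^ 2) m := hg.mono' (hf.aestronglyMeasurable.pow 2)
    (.of_forall fun x => by simpa only [norm_pow, Real.norm_eq_abs, sq_abs] using hfg x)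
  exact (even_two.convexOn_pow.map_integral_le (continuous_pow 2).continuousOn isClosed_univ
    (.of_forall fun _ => Set.mem_univ _) hf hsq).trans (integral_mono hsq hg hfg)

end CondLaw

/-! ### Convex and numerical estimates -/

section Analysis

theorem lipschitzWith_ciSup {α ι : Type*} [PseudoMetricSpace α] [Fintype ι] {f : ι → α → ℝ}
    {C : ι → ℝ≥0} (hf : ∀ i, LipschitzWith (C i) (f i)) :
    LipschitzWith (Finset.univ.sup C) fun x => ⨆ i, f i x := by
  rcases isEmpty_or_nonempty ι with _ | _
  · simpa only [Real.iSup_of_isEmpty] using LipschitzWith.const' (0 : ℝ)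
  · refine LipschitzWith.of_le_add_mul _ fun x y => ciSup_le fun i => ?_
    calc f i x ≤ f i y + Finset.univ.sup C * dist x y :=
          ((hf i).weaken (Finset.le_sup (Finset.mem_univ i))).le_add_mul x y
      _ ≤ (⨆ i, f i y) + Finset.univ.sup C * dist x y := by
          gcongr
          exact le_ciSup (f := fun i => f i y) (Set.finite_range _).bddAbove i

theorem convexOn_sum {E ι : Type*} [AddCommMonoid E] [Module ℝ E] {s : Set E} {t : Finset ι}
    (ht : t.Nonempty) {f : ι → E → ℝ} (hf : ∀ i ∈ t, ConvexOn ℝ s (f i)) :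
    ConvexOn ℝ s fun x => ∑ i ∈ t, f i x := by
  induction ht using Finset.Nonempty.cons_induction with
  | singleton i => simpa using hf
  | cons i t hi _ ih =>
    simp only [Finset.forall_mem_cons, Finset.sum_cons] at hf ⊢
    exact hf.1.add (ih hf.2)

theorem strictConvexOn_add_sq_norm_sub {E : Type*} [NormedAddCommGroup E]
    [InnerProductSpace ℝ E] {s : Set E} {f : E → ℝ} (hf : ConvexOn ℝ s f) {ρ : ℝ} (hρ : 0 < ρ)
    (x : E) : StrictConvexOn ℝ s fun y => f y + ρ / 2 * ‖y - x‖ ^ 2 := by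
  refine StrongConvexOn.strictConvexOn (strongConvexOn_iff_convex.2 ?_) hρ
  refine ((hf.add (((-ρ) • innerSL ℝ x).toLinearMap.convexOn hf.1)).add_const
    (ρ / 2 * ‖x‖ ^ 2)).congr fun y _ => ?_
  simp only [Pi.add_apply, ContinuousLinearMap.coe_coe, smul_apply,
    innerSL_apply_apply, smul_eq_mul, norm_sub_sq_real, real_inner_comm y x]
  ring

theorem continuous_of_unique_isMinOn {X Y : Type*} [TopologicalSpace X] [TopologicalSpace Y]
    [CompactSpace Y] {H : X → Y → ℝ} (hH : Continuous (Function.uncurry H)) {p : X → Y}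
    (hp : ∀ x, IsMinOn (H x) Set.univ (p x))
    (hunique : ∀ x y, IsMinOn (H x) Set.univ y → y = p x) : Continuous p := by
  refine continuous_iff_continuousAt.2 fun x => isCompact_univ.tendsto_nhds_of_unique_mapClusterPt
    (Eventually.of_forall fun _ => Set.mem_univ _) fun y _ hy => hunique x y ?_
  obtain ⟨U, hUx, hUy⟩ := mapClusterPt_iff_ultrafilter.1 hy
  have hlim {f : X → Y} {b : Y} (hf : Tendsto f U (𝓝 b)) :
      Tendsto (fun x' => H x' (f x')) U (𝓝 (H x b)) :=
    (hH.tendsto (x, b)).comp ((tendsto_id.mono_left hUx).prodMk_nhds hf)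
  exact isMinOn_univ_iff.2 fun b => le_of_tendsto_of_tendsto' (hlim hUy)
    (hlim tendsto_const_nhds) fun x' => isMinOn_univ_iff.1 (hp x') b

end Analysis

section Numeric

theorem mul_le_sq_div_add_mul_sq {η : ℝ} (hη : 0 < η) (s t : ℝ) :
    s * t ≤ s ^ 2 / (2 * η) + η / 2 * t ^ 2 := by
  have h : s ^ 2 / (2 * η) + η / 2 * t ^ 2 - s * t = (s - η * t) ^ 2 / (2 * η) := by
    field_simp
    ring
  linarith [h, show 0 ≤ (s - η * t) ^ 2 / (2 * η) by positivity]

theorem inv_sqrt_le_mul_sqrt_log_div {m : ℕ} (hm : 2 ≤ m) :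
    1 / √m ≤ (√(Real.log 2))⁻¹ * √(Real.log m / m) := by
  have hlog : √(Real.log 2) ≤ √(Real.log m) :=
    Real.sqrt_le_sqrt (Real.log_le_log two_pos (mod_cast hm))
  have hpos : 0 < √(Real.log 2) := Real.sqrt_pos.2 (Real.log_pos one_lt_two)
  rw [Real.sqrt_div' _ (Nat.cast_nonneg m), ← mul_div_assoc]
  gcongr
  rwa [inv_mul_eq_div, one_le_div hpos]

variable {N : ℕ → ℕ}

theorem sum_inv_sqrt_le_of_two_le (hN : ∀ ν, 2 ≤ N ν) (T : ℕ) :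
    ∑ ν ∈ Finset.range T, 1 / √(N ν) ≤
      (√(Real.log 2))⁻¹ * ∑ ν ∈ Finset.range T, √(Real.log (N ν) / N ν) := by
  rw [Finset.mul_sum]
  exact Finset.sum_le_sum fun ν _ => inv_sqrt_le_mul_sqrt_log_div (hN ν)

theorem sum_inv_sqrt_le_of_strictMono (hN : StrictMono N) (hN₀ : 1 ≤ N 0) {T : ℕ} (hT : 1 < T) :
    ∑ ν ∈ Finset.range T, 1 / √(N ν) ≤
      ((√(Real.log 2))⁻¹ + (√(Real.log (N 1) / N 1))⁻¹) *
        ∑ ν ∈ Finset.range T, √(Real.log (N ν) / N ν) := by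
  have htwo {ν : ℕ} (hν : ν ≠ 0) : 2 ≤ N ν :=
    Nat.succ_le_of_lt (hN₀.trans_lt (hN (Nat.pos_of_ne_zero hν)))
  have hterm (ν : ℕ) : 1 / √(N ν) ≤
      (√(Real.log 2))⁻¹ * √(Real.log (N ν) / N ν) + if ν = 0 then 1 else 0 := by
    split_ifs with hν
    · have hone : 1 / √(N ν) ≤ 1 := by
        rw [hν, div_le_one (by positivity)]
        exact Real.one_le_sqrt.2 (mod_cast hN₀)
      exact hone.trans (le_add_of_nonneg_left (by positivity))
    · simpa only [add_zero] using inv_sqrt_le_mul_sqrt_log_div (htwo hν)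
  have hfirst : 1 ≤ (√(Real.log (N 1) / N 1))⁻¹ *
      ∑ ν ∈ Finset.range T, √(Real.log (N ν) / N ν) := by
    have hlog : 0 < Real.log (N 1) := Real.log_pos (mod_cast htwo one_ne_zero)
    have hN₁ : (0 : ℝ) < N 1 := by exact_mod_cast two_pos.trans_le (htwo one_ne_zero)
    rw [inv_mul_eq_div, one_le_div (by positivity)]
    exact Finset.single_le_sum (f := fun ν => √(Real.log (N ν) / N ν))
      (fun _ _ => Real.sqrt_nonneg _) (Finset.mem_range.2 hT)
  calc ∑ ν ∈ Finset.range T, 1 / √(N ν)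
      ≤ ∑ ν ∈ Finset.range T,
          ((√(Real.log 2))⁻¹ * √(Real.log (N ν) / N ν) + if ν = 0 then 1 else 0) :=
        Finset.sum_le_sum fun ν _ => hterm ν
    _ = (√(Real.log 2))⁻¹ * ∑ ν ∈ Finset.range T, √(Real.log (N ν) / N ν) + 1 := by
        rw [Finset.sum_add_distrib, ← Finset.mul_sum, Finset.sum_ite_eq',
          if_pos (Finset.mem_range.2 (one_pos.trans hT))]
    _ ≤ _ := by
        rw [add_mul]
        gcongr

end Numeric

/-! ### Surrogates and proximal points -/

namespace SurrogateFamily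

variable {n d K q : ℕ} {Fhat : SurrogateFamily n d K q} {N : ℕ} (z : Fin N → Fin n)
  (x y : EuclideanSpace ℝ (Fin q)) (J : IndexMap n d K)

theorem avg_eq_expect : avg Fhat y x J = 𝔼 s, Fhat y x s J := by
  rw [avg, Fintype.expect_eq_sum_div_card, Fintype.card_fin, one_div_mul_eq_div]

theorem avgN_eq_expect : avgN Fhat z y x J = 𝔼 i, Fhat y x (z i) J := by
  rw [avgN, Fintype.expect_eq_sum_div_card, Fintype.card_fin, one_div_mul_eq_div]

theorem expect_avgN [NeZero n] [NeZero N] :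
    𝔼 z : Fin N → Fin n, avgN Fhat z y x J = avg Fhat y x J := by
  simp only [avgN_eq_expect, avg_eq_expect]
  exact expect_expect_pi_eval fun s => Fhat y x s J

end SurrogateFamily

namespace ERMProblem

variable {n d K q : ℕ} {P : ERMProblem n d K q} {Fhat : SurrogateFamily n d K q}

section Averages

variable {N : ℕ} (z : Fin N → Fin n) (x : EuclideanSpace ℝ (Fin q))

theorem F_eq_expect : P.F x = 𝔼 s, P.Fs x s := by
  rw [F, Fintype.expect_eq_sum_div_card, Fintype.card_fin, one_div_mul_eq_div]

theorem FN_eq_expect : P.FN z x = 𝔼 i, P.Fs x (z i) := by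
  rw [FN, Fintype.expect_eq_sum_div_card, Fintype.card_fin, one_div_mul_eq_div]

theorem rbar_eq_expect (ε ρ : ℝ) :
    P.rbar Fhat ε ρ x = 𝔼 J ∈ P.activeMaps ε x, ‖x - P.proxMap Fhat ρ J x‖ := by
  rw [rbar, Finset.expect_eq_sum_div_card, one_div_mul_eq_div]

theorem F_sub_FN : P.F x - P.FN z x = sampleDev z (P.Fs x) := by
  rw [F_eq_expect, FN_eq_expect, sampleDev]

theorem expect_FN [NeZero n] [NeZero N] : 𝔼 z : Fin N → Fin n, P.FN z x = P.F x := by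
  simp only [FN_eq_expect, F_eq_expect, expect_expect_pi_eval]

end Averages

section Objective

theorem exists_lipschitzWith_g (P : ERMProblem n d K q) (s : Fin n) (ι : Fin d) :
    ∃ C, LipschitzWith C fun θ => P.g θ s ι := by
  choose C hC using fun k => (P.gPiece s ι k).lipschitzWith_of_finiteDimensional
  exact ⟨_, lipschitzWith_ciSup hC⟩

theorem exists_lipschitzWith_h (P : ERMProblem n d K q) (s : Fin n) (ι : Fin d) :
    ∃ C, LipschitzWith C fun θ => P.h θ s ι := by
  choose C hC using fun k => (P.hPiece s ι k).lipschitzWith_of_finiteDimensional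
  exact ⟨_, lipschitzWith_ciSup hC⟩

theorem exists_lipschitzWith_f (P : ERMProblem n d K q) (s : Fin n) :
    ∃ C, LipschitzWith C fun θ => P.f θ s := by
  choose C hC using P.exists_lipschitzWith_g s
  choose D hD using P.exists_lipschitzWith_h s
  have hpi : LipschitzWith (Finset.univ.sup (C + D)) fun θ ι => P.g θ s ι - P.h θ s ι :=
    fun x y => edist_pi_le_iff.2 fun ι =>
      ((hC ι).sub (hD ι)).weaken (Finset.le_sup (f := C + D) (Finset.mem_univ ι)) x y
  exact ⟨_, (PiLp.lipschitzWith_toLp 2 _).comp hpi⟩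

theorem locallyLipschitz_Fs (hφ : ∀ s, LocallyLipschitz (P.φ s)) (s : Fin n) :
    LocallyLipschitz fun θ => P.Fs θ s :=
  (hφ s).comp (P.exists_lipschitzWith_f s).choose_spec.locallyLipschitz

theorem continuous_F (hφ : ∀ s, LocallyLipschitz (P.φ s)) : Continuous P.F :=
  continuous_const.mul (continuous_finsetSum _ fun s _ => (locallyLipschitz_Fs hφ s).continuous)

theorem continuous_FN (hφ : ∀ s, LocallyLipschitz (P.φ s)) {N : ℕ} (z : Fin N → Fin n) :
    Continuous (P.FN z) :=
  continuous_const.mul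
    (continuous_finsetSum _ fun i _ => (locallyLipschitz_Fs hφ (z i)).continuous)

theorem exists_lipschitzOnWith_Fs (hφ : ∀ s, LocallyLipschitz (P.φ s)) (hΘ : IsCompact P.Θ) :
    ∃ L, ∀ s, LipschitzOnWith L (fun θ => P.Fs θ s) P.Θ := by
  choose C hC using fun s =>
    ((locallyLipschitz_Fs hφ s).locallyLipschitzOn (s := P.Θ)).exists_lipschitzOnWith_of_compact hΘ
  exact ⟨Finset.univ.sup C, fun s => (hC s).weaken (Finset.le_sup (Finset.mem_univ s))⟩

end Objective

section ActiveMaps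

variable (P) (J : IndexMap n d K) (ε : ℝ) (x : EuclideanSpace ℝ (Fin q))

theorem mem_activeMaps {P : ERMProblem n d K q} {J : IndexMap n d K} {ε : ℝ}
    {x : EuclideanSpace ℝ (Fin q)} : J ∈ P.activeMaps ε x ↔
      (∀ ι s, P.g x s ι - ε ≤ P.gPiece s ι (J.1 ι s) x) ∧
      ∀ ι s, P.h x s ι - ε ≤ P.hPiece s ι (J.2 ι s) x := by
  rw [activeMaps, Finset.mem_filter_univ]

theorem activeMaps_nonempty [NeZero K] {ε : ℝ} (hε : 0 ≤ ε) : (P.activeMaps ε x).Nonempty := by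
  choose I₁ h₁ using fun (ι : Fin d) (s : Fin n) =>
    exists_eq_ciSup_of_finite (f := fun k => P.gPiece s ι k x)
  choose I₂ h₂ using fun (ι : Fin d) (s : Fin n) =>
    exists_eq_ciSup_of_finite (f := fun k => P.hPiece s ι k x)
  refine ⟨(I₁, I₂), mem_activeMaps.2 ⟨fun ι s => ?_, fun ι s => ?_⟩⟩
  · rw [g, ← h₁]
    linarith
  · rw [h, ← h₂]
    linarith

theorem exists_mem_activeMaps : ∃ ε, 0 ≤ ε ∧ J ∈ P.activeMaps ε x := by
  obtain ⟨a, ha⟩ := (Set.finite_range fun p : Fin d × Fin n =>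
    P.g x p.2 p.1 - P.gPiece p.2 p.1 (J.1 p.1 p.2) x).bddAbove
  obtain ⟨b, hb⟩ := (Set.finite_range fun p : Fin d × Fin n =>
    P.h x p.2 p.1 - P.hPiece p.2 p.1 (J.2 p.1 p.2) x).bddAbove
  refine ⟨max 0 (max a b), le_max_left _ _, mem_activeMaps.2 ⟨fun ι s => ?_, fun ι s => ?_⟩⟩
  · linarith [ha ⟨(ι, s), rfl⟩, le_max_left a b, le_max_right 0 (max a b)]
  · linarith [hb ⟨(ι, s), rfl⟩, le_max_right a b, le_max_right 0 (max a b)]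

theorem isClosed_setOf_mem_activeMaps : IsClosed {x | J ∈ P.activeMaps ε x} := by
  have hg (ι s) := (P.exists_lipschitzWith_g s ι).choose_spec.continuous
  have hh (ι s) := (P.exists_lipschitzWith_h s ι).choose_spec.continuous
  simp only [mem_activeMaps, Set.ofPred_and, Set.ofPred_forall]
  refine (isClosed_iInter fun ι => isClosed_iInter fun s => ?_).inter
    (isClosed_iInter fun ι => isClosed_iInter fun s => ?_)
  · exact isClosed_le ((hg ι s).sub continuous_const)
      (P.gPiece s ι _).continuous_of_finiteDimensional
  · exact isClosed_le ((hh ι s).sub continuous_const)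
      (P.hPiece s ι _).continuous_of_finiteDimensional

theorem measurable_activeMaps : Measurable (P.activeMaps ε) :=
  measurable_finset_iff.2 fun J =>
    measurableSet_setOfPred.1 (P.isClosed_setOf_mem_activeMaps J ε).measurableSet

end ActiveMaps

/-- What the descent argument needs from a surrogate family: convex majorants, for all index
mappings, that are jointly continuous in the argument and the reference point. -/
structure IsConvexMajorantFamily (P : ERMProblem n d K q) (Fhat : SurrogateFamily n d K q) :
    Prop where
  majorizes : ∀ θ' ∈ P.Θ, ∀ s J, ∀ θ ∈ P.Θ, P.Fs θ s ≤ Fhat θ θ' s J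
  convexOn : ∀ θ' ∈ P.Θ, ∀ s J, ConvexOn ℝ P.Θ fun θ => Fhat θ θ' s J
  continuousOn : ∀ s J, ContinuousOn
    (fun p : EuclideanSpace ℝ (Fin q) × EuclideanSpace ℝ (Fin q) => Fhat p.1 p.2 s J)
    (P.Θ ×ˢ P.Θ)

theorem IsSurrogateFamily.isConvexMajorantFamily (hF : P.IsSurrogateFamily Fhat) :
    P.IsConvexMajorantFamily Fhat where
  majorizes θ' hθ' s J :=
    have ⟨ε, hε, hJ⟩ := P.exists_mem_activeMaps J θ'
    hF.majorizes ε hε θ' hθ' s J hJ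
  convexOn θ' hθ' s J :=
    have ⟨ε, hε, hJ⟩ := P.exists_mem_activeMaps J θ'
    hF.convex ε hε θ' hθ' s J hJ
  continuousOn := hF.continuous

end ERMProblem

namespace ERMProblem

variable {n d K q : ℕ} {P : ERMProblem n d K q} {Fhat : SurrogateFamily n d K q}

namespace IsConvexMajorantFamily

variable (hF : P.IsConvexMajorantFamily Fhat) {N : ℕ} (z : Fin N → Fin n) (J : IndexMap n d K)
  (ρ : ℝ)

include hF

theorem continuous_surrogate (s : Fin n) :
    Continuous fun p : P.Θ × P.Θ => Fhat p.1 p.2 s J :=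
  (hF.continuousOn s J).comp_continuous
    (f := fun p : P.Θ × P.Θ =>
      ((p.1 : EuclideanSpace ℝ (Fin q)), (p.2 : EuclideanSpace ℝ (Fin q))))
    (by fun_prop) fun p => ⟨p.1.2, p.2.2⟩

theorem continuous_avgN :
    Continuous fun p : P.Θ × P.Θ => SurrogateFamily.avgN Fhat z p.1 p.2 J :=
  continuous_const.mul (continuous_finsetSum _ fun i _ => hF.continuous_surrogate J (z i))

theorem continuous_proxObj :
    Continuous fun p : P.Θ × P.Θ => proxObj Fhat ρ p.1 J p.2 :=
  (continuous_const.mul (continuous_finsetSum _ fun s _ =>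
    (hF.continuous_surrogate J s).comp continuous_swap)).add (by fun_prop)

theorem FN_le_avgN {x y : EuclideanSpace ℝ (Fin q)} (hx : x ∈ P.Θ) (hy : y ∈ P.Θ) :
    P.FN z y ≤ SurrogateFamily.avgN Fhat z y x J :=
  mul_le_mul_of_nonneg_left (Finset.sum_le_sum fun i _ => hF.majorizes x hx (z i) J y hy)
    (by positivity)

theorem F_le_avg {x y : EuclideanSpace ℝ (Fin q)} (hx : x ∈ P.Θ) (hy : y ∈ P.Θ) :
    P.F y ≤ SurrogateFamily.avg Fhat y x J :=
  hF.FN_le_avgN id J hx hy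

theorem strictConvexOn_proxObj [NeZero n] {x : EuclideanSpace ℝ (Fin q)} (hx : x ∈ P.Θ)
    (hρ : 0 < ρ) : StrictConvexOn ℝ P.Θ (proxObj Fhat ρ x J) :=
  strictConvexOn_add_sq_norm_sub ((convexOn_sum Finset.univ_nonempty fun s _ =>
    hF.convexOn x hx s J).smul (by positivity)) hρ x

variable [CompactSpace P.Θ]

theorem prox_mem_and_isMinOn (x : P.Θ) :
    P.prox Fhat ρ x J ∈ P.Θ ∧ IsMinOn (proxObj Fhat ρ x J) P.Θ (P.prox Fhat ρ x J) := by
  have hcont : ContinuousOn (proxObj Fhat ρ x J) P.Θ :=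
    continuousOn_iff_continuous_domRestrict.2
      ((hF.continuous_proxObj J ρ).comp (Continuous.prodMk_right x))
  have hΘ : IsCompact P.Θ := isCompact_iff_compactSpace.2 inferInstance
  exact Classical.epsilon_spec (hΘ.exists_isMinOn ⟨x, x.2⟩ hcont)

theorem prox_mem (x : P.Θ) : P.prox Fhat ρ x J ∈ P.Θ :=
  (hF.prox_mem_and_isMinOn J ρ x).1

theorem isMinOn_prox (x : P.Θ) : IsMinOn (proxObj Fhat ρ x J) P.Θ (P.prox Fhat ρ x J) :=
  (hF.prox_mem_and_isMinOn J ρ x).2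

variable {ρ}

theorem continuous_prox [NeZero n] (hρ : 0 < ρ) :
    Continuous fun x : P.Θ => (⟨P.prox Fhat ρ x J, hF.prox_mem J ρ x⟩ : P.Θ) := by
  refine continuous_of_unique_isMinOn (H := fun x y : P.Θ => proxObj Fhat ρ x J y)
    (hF.continuous_proxObj J ρ)
    (fun x => isMinOn_univ_iff.2 fun y => isMinOn_iff.1 (hF.isMinOn_prox J ρ x) y y.2)
    fun x y hy => ?_
  exact Subtype.ext ((hF.strictConvexOn_proxObj J ρ x.2 hρ).eq_of_isMinOn
    (isMinOn_iff.2 fun w hw => isMinOn_univ_iff.1 hy ⟨w, hw⟩) (hF.isMinOn_prox J ρ x)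
    y.2 (hF.prox_mem J ρ x))

theorem integrable_ite_proxObj_le [NeZero n] (hφ : ∀ s, LocallyLipschitz (P.φ s)) (hρ : 0 < ρ)
    {m : Measure P.Θ} [IsFiniteMeasure m] {a b : P.Θ → ℝ} (ha : Continuous a)
    (hb : Continuous b) :
    Integrable (fun x : P.Θ => open Classical in
      if proxObj Fhat ρ x J (P.prox Fhat ρ x J) ≤ P.F x then a x else b x) m :=
  integrable_ite_le ((hF.continuous_proxObj J ρ).comp
    (continuous_id.prodMk (hF.continuous_prox J hρ)))
    ((continuous_F hφ).comp continuous_subtype_val) ha hb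

theorem integrable_norm_sub_proxMap_pow [NeZero n] (hφ : ∀ s, LocallyLipschitz (P.φ s))
    (hρ : 0 < ρ) {m : Measure P.Θ} [IsFiniteMeasure m] (k : ℕ) :
    Integrable (fun x : P.Θ => ‖(x : EuclideanSpace ℝ (Fin q)) - P.proxMap Fhat ρ J x‖ ^ k) m := by
  have hprox := continuous_subtype_val.comp (hF.continuous_prox J hρ)
  refine (hF.integrable_ite_proxObj_le J hφ hρ
    ((continuous_subtype_val.sub hprox).norm.pow k)
    ((continuous_subtype_val.sub continuous_subtype_val).norm.pow k)).congr (.of_forall fun x => ?_)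
  simp only [proxMap]
  split_ifs <;> rfl

theorem integrable_rbar [NeZero n] (hφ : ∀ s, LocallyLipschitz (P.φ s)) (hρ : 0 < ρ) (ε : ℝ)
    {m : Measure P.Θ} [IsFiniteMeasure m] :
    Integrable (fun x : P.Θ => P.rbar Fhat ε ρ x) m := by
  simp only [rbar_eq_expect]
  refine integrable_expect ((P.measurable_activeMaps ε).comp measurable_subtype_coe) fun J => ?_
  simpa only [pow_one] using hF.integrable_norm_sub_proxMap_pow J hφ hρ 1

end IsConvexMajorantFamily

/-- The average over the `ε`-active index mappings of the squared residual; it dominates the square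
of `rbar` and is the quantity controlled by the descent of the objective. -/
noncomputable def meanSqResidual (P : ERMProblem n d K q) (Fhat : SurrogateFamily n d K q)
    (ε ρ : ℝ) (x : EuclideanSpace ℝ (Fin q)) : ℝ :=
  𝔼 J ∈ P.activeMaps ε x, ‖x - P.proxMap Fhat ρ J x‖ ^ 2

theorem rbar_sq_le_meanSqResidual (ε ρ : ℝ) (x : EuclideanSpace ℝ (Fin q)) :
    P.rbar Fhat ε ρ x ^ 2 ≤ P.meanSqResidual Fhat ε ρ x := by
  rw [rbar_eq_expect]
  exact sq_expect_le _ _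

theorem IsConvexMajorantFamily.integrable_meanSqResidual [NeZero n] [CompactSpace P.Θ]
    (hF : P.IsConvexMajorantFamily Fhat) (hφ : ∀ s, LocallyLipschitz (P.φ s)) {ρ : ℝ}
    (hρ : 0 < ρ) (ε : ℝ) {m : Measure P.Θ} [IsFiniteMeasure m] :
    Integrable (fun x : P.Θ => P.meanSqResidual Fhat ε ρ x) m :=
  integrable_expect ((P.measurable_activeMaps ε).comp measurable_subtype_coe) fun J =>
    hF.integrable_norm_sub_proxMap_pow J hφ hρ 2

end ERMProblem

/-! ### One iteration -/

namespace ERMProblem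

variable {n d K q : ℕ} {P : ERMProblem n d K q} {Fhat : SurrogateFamily n d K q}

open Classical in
/-- A bound, up to sampling errors, for the objective value after one iteration started at `x` with
sample `z` and index mapping `J`. It is obtained by comparing the candidate with the proximal point
`prox` that defines the residual, which is deterministic given `x` and `J`. -/
noncomputable def stepBound (P : ERMProblem n d K q) (Fhat : SurrogateFamily n d K q) (η ρ : ℝ)
    {N : ℕ} (z : Fin N → Fin n) (J : IndexMap n d K) (x : EuclideanSpace ℝ (Fin q)) : ℝ :=
  P.F x +
    if proxObj Fhat ρ x J (P.prox Fhat ρ x J) ≤ P.F x then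
      SurrogateFamily.avgN Fhat z (P.prox Fhat ρ x J) x J +
        η / 2 * ‖P.prox Fhat ρ x J - x‖ ^ 2 - P.FN z x
    else 0

section Objective

variable [CompactSpace P.Θ] (hφ : ∀ s, LocallyLipschitz (P.φ s)) {m : Measure P.Θ}
include hφ

theorem integrable_F [IsFiniteMeasure m] : Integrable (fun x : P.Θ => P.F x) m :=
  ((continuous_F hφ).comp continuous_subtype_val).integrable_of_hasCompactSupport
    (.of_compactSpace _)

theorem sInf_image_F_le {x : EuclideanSpace ℝ (Fin q)} (hx : x ∈ P.Θ) :
    sInf (P.F '' P.Θ) ≤ P.F x :=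
  csInf_le ((isCompact_iff_compactSpace.2 inferInstance).bddBelow_image
    (continuous_F hφ).continuousOn) (Set.mem_image_of_mem _ hx)

theorem sInf_image_F_le_integral [IsProbabilityMeasure m] :
    sInf (P.F '' P.Θ) ≤ ∫ x : P.Θ, P.F x ∂m := by
  simpa only [integral_const, probReal_univ, one_smul] using
    integral_mono (integrable_const _) (integrable_F hφ (m := m)) fun x => sInf_image_F_le hφ x.2

end Objective

section Step

variable {N : ℕ} {z : Fin N → Fin n} {J : IndexMap n d K} {η ρ : ℝ}

theorem expect_stepBound_le [NeZero n] [NeZero N] (x : EuclideanSpace ℝ (Fin q)) :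
    𝔼 z : Fin N → Fin n, P.stepBound Fhat η ρ z J x ≤
      P.F x - (ρ - η) / 2 * ‖x - P.proxMap Fhat ρ J x‖ ^ 2 := by
  rw [proxMap]
  simp only [stepBound]
  split_ifs with hle
  · simp only [Finset.expect_add_distrib, Finset.expect_sub_distrib, Fintype.expect_const,
      SurrogateFamily.expect_avgN, expect_FN]
    rw [proxObj] at hle
    rw [norm_sub_rev x]
    linarith
  · simp

theorem expect_expect_stepBound_add_le [NeZero n] [NeZero N] [NeZero K] {ε : ℝ} (hε : 0 ≤ ε)
    (e : (Fin N → Fin n) → ℝ) (x : EuclideanSpace ℝ (Fin q)) :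
    𝔼 J ∈ P.activeMaps ε x, 𝔼 z, (P.stepBound Fhat η ρ z J x + e z) ≤
      P.F x - (ρ - η) / 2 * P.meanSqResidual Fhat ε ρ x + 𝔼 z, e z := by
  have hne := P.activeMaps_nonempty x hε
  calc 𝔼 J ∈ P.activeMaps ε x, 𝔼 z, (P.stepBound Fhat η ρ z J x + e z)
      ≤ 𝔼 J ∈ P.activeMaps ε x,
          (P.F x - (ρ - η) / 2 * ‖x - P.proxMap Fhat ρ J x‖ ^ 2 + 𝔼 z, e z) := by
        refine Finset.expect_le_expect fun J _ => ?_
        rw [Finset.expect_add_distrib]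
        gcongr
        exact expect_stepBound_le x
    _ = P.F x - (ρ - η) / 2 * P.meanSqResidual Fhat ε ρ x + 𝔼 z, e z := by
        rw [Finset.expect_add_distrib, Finset.expect_sub_distrib, ← Finset.mul_expect,
          Finset.expect_const hne, Finset.expect_const hne, meanSqResidual]

variable [CompactSpace P.Θ] (hF : P.IsConvexMajorantFamily Fhat)
include hF

theorem IsConvexMajorantFamily.integrable_stepBound [NeZero n]
    (hφ : ∀ s, LocallyLipschitz (P.φ s)) (hρ : 0 < ρ) {m : Measure P.Θ} [IsFiniteMeasure m] :
    Integrable (fun x : P.Θ => P.stepBound Fhat η ρ z J x) m := by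
  have hFN : Continuous fun x : P.Θ => P.FN z x :=
    (continuous_FN hφ z).comp continuous_subtype_val
  have hprox := hF.continuous_prox J hρ
  refine (integrable_F hφ).add
    (hF.integrable_ite_proxObj_le J hφ hρ (.sub (.add ?_ ?_) hFN) continuous_const)
  · exact (hF.continuous_avgN z J).comp (hprox.prodMk continuous_id)
  · exact continuous_const.mul
      (((continuous_subtype_val.comp hprox).sub continuous_subtype_val).norm.pow 2)

theorem IsConvexMajorantFamily.le_stepBound_add {x y w : EuclideanSpace ℝ (Fin q)} {e : ℝ}
    (hx : x ∈ P.Θ) (hy : y ∈ P.Θ)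
    (hmin : IsMinOn (fun v => SurrogateFamily.avgN Fhat z v x J + η / 2 * ‖v - x‖ ^ 2) P.Θ y)
    (hw : w = open Classical in
      if SurrogateFamily.avgN Fhat z y x J + η / 2 * ‖y - x‖ ^ 2 ≤ P.FN z x then y else x)
    (he : P.F w - P.FN z w - (P.F x - P.FN z x) ≤ e + η / 2 * ‖w - x‖ ^ 2) :
    P.F w ≤ P.stepBound Fhat η ρ z J x + e := by
  suffices hsample : P.FN z w + η / 2 * ‖w - x‖ ^ 2 ≤
      P.FN z x + (P.stepBound Fhat η ρ z J x - P.F x) by linarith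
  have hprox := isMinOn_iff.1 hmin _ (hF.prox_mem J ρ ⟨x, hx⟩)
  rw [stepBound, add_sub_cancel_left]
  split_ifs at hw with haccept <;> subst hw
  · have hmaj := hF.FN_le_avgN z J hx hy
    split_ifs <;> linarith
  · simp only [sub_self, norm_zero]
    split_ifs <;> linarith

end Step

end ERMProblem

/-! ### Runs of the algorithm -/

namespace ERMProblem

variable {n d K q : ℕ}

open Classical in
/-- The probability, given the current iterate `x`, of drawing the index mapping `p.1` and the
sample `p.2`. -/
noncomputable def drawProb (P : ERMProblem n d K q) (ε : ℝ) {N : ℕ}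
    (p : IndexMap n d K × (Fin N → Fin n)) (x : P.Θ) : ℝ≥0 :=
  (if p.1 ∈ P.activeMaps ε x then ((P.activeMaps ε x).card : ℝ≥0)⁻¹ else 0) * ((n : ℝ≥0)⁻¹) ^ N

variable {P : ERMProblem n d K q} {ε : ℝ} {N : ℕ}

theorem measurable_drawProb (p : IndexMap n d K × (Fin N → Fin n)) :
    Measurable (P.drawProb ε p) := by
  classical
  exact (Measurable.of_discrete (f := fun A : Finset (IndexMap n d K) =>
    (if p.1 ∈ A then (A.card : ℝ≥0)⁻¹ else 0) * ((n : ℝ≥0)⁻¹) ^ N)).comp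
    ((P.measurable_activeMaps ε).comp measurable_subtype_coe)

theorem coe_drawProb [NeZero n] (J : IndexMap n d K) (z : Fin N → Fin n) (x : P.Θ) :
    (P.drawProb ε (J, z) x : ℝ≥0∞) = open Classical in
      (if J ∈ P.activeMaps ε x then ((P.activeMaps ε x).card : ℝ≥0∞)⁻¹ else 0) *
        ((n : ℝ≥0∞)⁻¹) ^ N := by
  simp only [drawProb]
  split_ifs with hJ
  · have hcard : ((P.activeMaps ε x).card : ℝ≥0) ≠ 0 :=
      Nat.cast_ne_zero.2 (Finset.card_ne_zero_of_mem hJ)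
    rw [ENNReal.coe_mul, ENNReal.coe_pow, ENNReal.coe_inv hcard,
      ENNReal.coe_inv (NeZero.ne _), ENNReal.coe_natCast, ENNReal.coe_natCast]
  · simp

theorem sum_drawProb_smul (f : IndexMap n d K × (Fin N → Fin n) → ℝ) (x : P.Θ) :
    ∑ p, P.drawProb ε p x • f p = 𝔼 J ∈ P.activeMaps ε x, 𝔼 z, f (J, z) := by
  classical
  rw [Fintype.sum_prod_type]
  simp only [drawProb, ite_mul, zero_mul, ite_smul, zero_smul, Finset.sum_ite_irrel,
    Finset.sum_const_zero, Finset.sum_ite_mem, Finset.univ_inter]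
  rw [Finset.expect_eq_sum_div_card, Finset.sum_div]
  refine Finset.sum_congr rfl fun J _ => ?_
  rw [Fintype.expect_eq_sum_div_card, ← Finset.smul_sum, NNReal.smul_def]
  simp only [inv_pow, NNReal.coe_mul, NNReal.coe_inv, NNReal.coe_natCast, NNReal.coe_pow,
    smul_eq_mul, Fintype.card_pi, Fintype.card_fin, Finset.prod_const, Finset.card_univ,
    Nat.cast_pow]
  field_simp

end ERMProblem

namespace SMMRun

variable {n d K q : ℕ} {P : ERMProblem n d K q} {Fhat : SurrogateFamily n d K q} {ε η : ℝ}
  {N : ℕ → ℕ} {T : ℕ} {θ₀ : EuclideanSpace ℝ (Fin q)} {Ω : Type*} [MeasurableSpace Ω]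
  {μ : Measure Ω} (R : SMMRun P Fhat ε η N T θ₀ μ) (h₀ : θ₀ ∈ P.Θ) {ν : ℕ}

include h₀ in
theorem θ_mem (hν : ν ≤ T) (ω : Ω) : R.θ ν ω ∈ P.Θ := by
  induction ν with
  | zero => rwa [R.initial]
  | succ ν ih =>
    rw [R.update ν hν]
    split_ifs
    exacts [(R.candidate ν hν ω).1, ih (Nat.le_of_succ_le hν)]

/-- The iterates of a run as random points of `Θ`. The sequence is stopped at time `T`, after which
the iterates of a run are unspecified. -/
def iterate (ν : ℕ) (ω : Ω) : P.Θ :=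
  ⟨R.θ (min ν T) ω, R.θ_mem h₀ (min_le_right ν T) ω⟩

theorem coe_iterate (hν : ν ≤ T) (ω : Ω) :
    (R.iterate h₀ ν ω : EuclideanSpace ℝ (Fin q)) = R.θ ν ω :=
  congrArg (R.θ · ω) (min_eq_left hν)

theorem measurable_iterate_filtration : Measurable[R.𝓕 ν] (R.iterate h₀ ν) :=
  ((R.measurable_θ _ (min_le_right ν T)).mono (R.𝓕.mono (min_le_left ν T)) le_rfl).subtype_mk

theorem measurable_iterate : Measurable (R.iterate h₀ ν) :=
  (R.measurable_iterate_filtration h₀).mono (R.𝓕.le ν) le_rfl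

/-- The law of the `ν`-th iterate. -/
noncomputable def law (ν : ℕ) : Measure P.Θ :=
  μ.map (R.iterate h₀ ν)

instance [IsProbabilityMeasure μ] : IsProbabilityMeasure (R.law h₀ ν) :=
  Measure.isProbabilityMeasure_map (R.measurable_iterate h₀).aemeasurable

theorem integral_law_zero [IsProbabilityMeasure μ] (f : EuclideanSpace ℝ (Fin q) → ℝ) :
    ∫ x : P.Θ, f x ∂(R.law h₀ 0) = f θ₀ := by
  have hconst : R.iterate h₀ 0 = fun _ => ⟨θ₀, h₀⟩ :=
    funext fun ω => Subtype.ext ((R.coe_iterate h₀ (Nat.zero_le T) ω).trans (R.initial ω))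
  rw [law, hconst, Measure.map_const, measure_univ, one_smul, integral_dirac]

theorem hasCondLaw_draw [NeZero n] (hν : ν < T) :
    HasCondLaw (fun ω => (R.I ν ω, R.ξ ν ω)) (R.iterate h₀ ν) (P.drawProb ε) μ := by
  rintro ⟨J, z⟩ B hB
  simp only [P.coe_drawProb, R.coe_iterate h₀ hν.le]
  rw [← R.draw ν hν _ (R.measurable_iterate_filtration h₀ hB) J z]
  simp only [Set.preimage, Set.mem_singleton_iff, Prod.mk.injEq]

theorem measurable_draw (hν : ν < T) : Measurable fun ω => (R.I ν ω, R.ξ ν ω) :=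
  ((R.measurable_I ν hν).mono (R.𝓕.le _) le_rfl).prodMk
    ((R.measurable_ξ ν hν).mono (R.𝓕.le _) le_rfl)

theorem integrable_draw (hν : ν < T) {ψ : IndexMap n d K → (Fin (N ν) → Fin n) → P.Θ → ℝ}
    (hψ : ∀ J z, Integrable (ψ J z) (R.law h₀ ν)) :
    Integrable (fun ω => ψ (R.I ν ω) (R.ξ ν ω) (R.iterate h₀ ν ω)) μ :=
  integrable_comp_of_finite (ψ := fun p => ψ p.1 p.2) (R.measurable_draw hν)
    (R.measurable_iterate h₀) fun p => hψ p.1 p.2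

theorem integral_draw [NeZero n] (hν : ν < T) {ψ : IndexMap n d K → (Fin (N ν) → Fin n) → P.Θ → ℝ}
    (hψ : ∀ J z, Integrable (ψ J z) (R.law h₀ ν)) :
    ∫ ω, ψ (R.I ν ω) (R.ξ ν ω) (R.iterate h₀ ν ω) ∂μ =
      ∫ x : P.Θ, 𝔼 J ∈ P.activeMaps ε x, 𝔼 z, ψ J z x ∂(R.law h₀ ν) := by
  rw [(R.hasCondLaw_draw h₀ hν).integral_comp (R.measurable_iterate h₀)
    (ψ := fun p => ψ p.1 p.2) P.measurable_drawProb (R.measurable_draw hν) fun p => hψ p.1 p.2]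
  simp only [P.sum_drawProb_smul]
  rfl

end SMMRun

namespace SMMRun

variable {n d K q : ℕ} {P : ERMProblem n d K q} {Fhat : SurrogateFamily n d K q} {ε η : ℝ}
  {N : ℕ → ℕ} {T : ℕ} {θ₀ : EuclideanSpace ℝ (Fin q)} {Ω : Type*} [MeasurableSpace Ω]
  {μ : Measure Ω} (R : SMMRun P Fhat ε η N T θ₀ μ) (h₀ : θ₀ ∈ P.Θ) {ν : ℕ}

section Output

theorem output_eq_iterate (ω : Ω) : R.output ω = R.iterate h₀ (R.τ ω) ω :=
  (R.coe_iterate h₀ (R.τ ω).2.le ω).symm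

theorem measurable_iterates : Measurable fun ω (t : Fin T) => R.iterate h₀ t ω :=
  measurable_pi_iff.2 fun _ => R.measurable_iterate h₀

theorem indepFun_iterates : IndepFun R.τ (fun ω (t : Fin T) => R.iterate h₀ t ω) μ := by
  refine indep_of_indep_of_le_right R.output_indep (Measurable.comap_le ?_)
  refine @measurable_pi_lambda _ _ _ (MeasurableSpace.comap _ _) _ _ fun t => ?_
  refine @Measurable.subtype_mk _ _ (MeasurableSpace.comap _ _) _ _ _ ?_ _
  simp only [min_eq_left t.2.le]
  exact (measurable_pi_apply t).comp (comap_measurable fun ω (t : Fin T) => R.θ t ω)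

theorem hasCondLaw_output :
    HasCondLaw R.τ (fun ω (t : Fin T) => R.iterate h₀ t ω) (fun _ _ => (T : ℝ≥0)⁻¹) μ := by
  intro t B hB
  have hT : (T : ℝ≥0) ≠ 0 := Nat.cast_ne_zero.2 (Nat.ne_of_gt t.pos)
  rw [Set.inter_comm, (R.indepFun_iterates h₀).measure_inter_preimage_eq_mul _ _
    (measurableSet_singleton t) hB, lintegral_const, Measure.restrict_apply_univ,
    ENNReal.coe_inv hT, ENNReal.coe_natCast]
  exact congrArg (· * _) (R.output_uniform t)

variable {ψ : P.Θ → ℝ}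

theorem law_eq_map_iterates (t : Fin T) : R.law h₀ t =
    (μ.map fun ω (t : Fin T) => R.iterate h₀ t ω).map fun x => x t :=
  (Measure.map_map (measurable_pi_apply t) (R.measurable_iterates h₀)).symm

theorem integrable_iterates (hψ : ∀ ν, Integrable ψ (R.law h₀ ν)) (t : Fin T) :
    Integrable (fun x : Fin T → P.Θ => ψ (x t))
      (μ.map fun ω (t : Fin T) => R.iterate h₀ t ω) :=
  Integrable.comp_measurable (R.law_eq_map_iterates h₀ t ▸ hψ t) (measurable_pi_apply t)

theorem integrable_output (hψ : ∀ ν, Integrable ψ (R.law h₀ ν)) :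
    Integrable (fun ω => ψ (R.iterate h₀ (R.τ ω) ω)) μ :=
  integrable_comp_of_finite (ψ := fun t x => ψ (x t)) R.measurable_τ (R.measurable_iterates h₀)
    (R.integrable_iterates h₀ hψ)

theorem integral_output (hψ : ∀ ν, Integrable ψ (R.law h₀ ν)) :
    ∫ ω, ψ (R.iterate h₀ (R.τ ω) ω) ∂μ = 𝔼 t : Fin T, ∫ x, ψ x ∂(R.law h₀ t) := by
  have hint := R.integrable_iterates h₀ hψ
  have hlaw (t : Fin T) : ∫ x, ψ x ∂(R.law h₀ t) =
      ∫ x, ψ (x t) ∂(μ.map fun ω (t : Fin T) => R.iterate h₀ t ω) := by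
    rw [R.law_eq_map_iterates, integral_map (measurable_pi_apply t).aemeasurable
      (R.law_eq_map_iterates h₀ t ▸ (hψ t).aestronglyMeasurable)]
  rw [(R.hasCondLaw_output h₀).integral_comp (ψ := fun t x => ψ (x t)) (R.measurable_iterates h₀)
    (fun _ => measurable_const) R.measurable_τ hint]
  simp only [hlaw, Fintype.expect_eq_sum_div_card, Fintype.card_fin,
    NNReal.smul_def, smul_eq_mul, NNReal.coe_inv, NNReal.coe_natCast, inv_mul_eq_div,
    ← Finset.sum_div]
  rw [integral_div, integral_finsetSum _ fun t _ => hint t]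

end Output

section Descent

variable [CompactSpace P.Θ] {ρ : ℝ} {e : (Fin (N ν) → Fin n) → ℝ}

theorem F_iterate_succ_le (hF : P.IsConvexMajorantFamily Fhat) (hν : ν < T)
    (he : ∀ z, ∀ x ∈ P.Θ, ∀ y ∈ P.Θ,
      P.F y - P.FN z y - (P.F x - P.FN z x) ≤ e z + η / 2 * ‖y - x‖ ^ 2) (ω : Ω) :
    P.F (R.iterate h₀ (ν + 1) ω) ≤
      P.stepBound Fhat η ρ (R.ξ ν ω) (R.I ν ω) (R.iterate h₀ ν ω) + e (R.ξ ν ω) := by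
  have hmem := R.θ_mem h₀ hν.le ω
  rw [R.coe_iterate h₀ hν.le]
  exact hF.le_stepBound_add hmem (R.candidate ν hν ω).1 (R.candidate ν hν ω).2
    ((R.coe_iterate h₀ hν ω).trans (R.update ν hν ω))
    (he _ _ hmem _ (R.iterate h₀ (ν + 1) ω).2)

variable [IsProbabilityMeasure μ] [NeZero n] [NeZero K]

theorem integral_F_succ_le [NeZero (N ν)] (hφ : ∀ s, LocallyLipschitz (P.φ s))
    (hF : P.IsConvexMajorantFamily Fhat) (hε : 0 ≤ ε) (hρ : 0 < ρ) (hν : ν < T)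
    (he : ∀ z, ∀ x ∈ P.Θ, ∀ y ∈ P.Θ,
      P.F y - P.FN z y - (P.F x - P.FN z x) ≤ e z + η / 2 * ‖y - x‖ ^ 2) :
    ∫ x : P.Θ, P.F x ∂(R.law h₀ (ν + 1)) ≤
      ∫ x : P.Θ, P.F x ∂(R.law h₀ ν) -
        (ρ - η) / 2 * ∫ x : P.Θ, P.meanSqResidual Fhat ε ρ x ∂(R.law h₀ ν) + 𝔼 z, e z := by
  have hFint (m : Measure P.Θ) [IsFiniteMeasure m] := ERMProblem.integrable_F hφ (m := m)
  have hres := hF.integrable_meanSqResidual hφ hρ ε (m := R.law h₀ ν)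
  have hdiff : Integrable (fun x : P.Θ =>
      P.F x - (ρ - η) / 2 * P.meanSqResidual Fhat ε ρ x) (R.law h₀ ν) :=
    (hFint _).sub (hres.const_mul _)
  have hstep (J) (z : Fin (N ν) → Fin n) :
      Integrable (fun x : P.Θ => P.stepBound Fhat η ρ z J x + e z) (R.law h₀ ν) :=
    (hF.integrable_stepBound hφ hρ).add (integrable_const _)
  calc ∫ x : P.Θ, P.F x ∂(R.law h₀ (ν + 1))
      = ∫ ω, P.F (R.iterate h₀ (ν + 1) ω) ∂μ :=
        integral_map (R.measurable_iterate h₀).aemeasurable (hFint _).aestronglyMeasurable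
    _ ≤ ∫ ω, P.stepBound Fhat η ρ (R.ξ ν ω) (R.I ν ω) (R.iterate h₀ ν ω) + e (R.ξ ν ω) ∂μ :=
        integral_mono ((hFint _).comp_measurable (R.measurable_iterate h₀))
          (R.integrable_draw h₀ hν hstep) (R.F_iterate_succ_le h₀ hF hν he)
    _ = ∫ x : P.Θ, 𝔼 J ∈ P.activeMaps ε x, 𝔼 z, (P.stepBound Fhat η ρ z J x + e z)
          ∂(R.law h₀ ν) := R.integral_draw h₀ hν hstep
    _ ≤ ∫ x : P.Θ, P.F x - (ρ - η) / 2 * P.meanSqResidual Fhat ε ρ x + 𝔼 z, e z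
          ∂(R.law h₀ ν) :=
        integral_mono (integrable_expect ((P.measurable_activeMaps ε).comp measurable_subtype_coe)
            fun J => integrable_expect measurable_const (hstep J))
          (hdiff.add (integrable_const _))
          fun x => P.expect_expect_stepBound_add_le hε e x
    _ = _ := by
        rw [integral_add hdiff (integrable_const _), integral_sub (hFint _) (hres.const_mul _),
          integral_const_mul, integral_const, probReal_univ, one_smul]

theorem sum_integral_meanSqResidual_le (hφ : ∀ s, LocallyLipschitz (P.φ s))
    (hF : P.IsConvexMajorantFamily Fhat) (hε : 0 ≤ ε) (hρ : 0 < ρ) (hN : ∀ ν, 1 ≤ N ν)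
    {e : (ν : ℕ) → (Fin (N ν) → Fin n) → ℝ}
    (he : ∀ ν z, ∀ x ∈ P.Θ, ∀ y ∈ P.Θ,
      P.F y - P.FN z y - (P.F x - P.FN z x) ≤ e ν z + η / 2 * ‖y - x‖ ^ 2) :
    (ρ - η) / 2 * ∑ ν ∈ Finset.range T, ∫ x : P.Θ, P.meanSqResidual Fhat ε ρ x ∂(R.law h₀ ν) ≤
      P.F θ₀ - sInf (P.F '' P.Θ) + ∑ ν ∈ Finset.range T, 𝔼 z, e ν z := by
  have hstep (ν : ℕ) (hν : ν ∈ Finset.range T) :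
      (ρ - η) / 2 * ∫ x : P.Θ, P.meanSqResidual Fhat ε ρ x ∂(R.law h₀ ν) - 𝔼 z, e ν z ≤
        ∫ x : P.Θ, P.F x ∂(R.law h₀ ν) - ∫ x : P.Θ, P.F x ∂(R.law h₀ (ν + 1)) := by
    have : NeZero (N ν) := ⟨Nat.one_le_iff_ne_zero.1 (hN ν)⟩
    linarith [R.integral_F_succ_le h₀ hφ hF hε hρ (Finset.mem_range.1 hν) (he ν)]
  have hlast : sInf (P.F '' P.Θ) ≤ ∫ x : P.Θ, P.F x ∂(R.law h₀ T) :=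
    ERMProblem.sInf_image_F_le_integral hφ
  have hsum := Finset.sum_le_sum hstep
  rw [Finset.sum_sub_distrib, ← Finset.mul_sum, Finset.sum_range_sub', R.integral_law_zero h₀ P.F]
    at hsum
  linarith

end Descent

end SMMRun

/-! ### Rates -/

namespace ERMProblem

variable {n d K q : ℕ} {P : ERMProblem n d K q} {Fhat : SurrogateFamily n d K q}

theorem samplingError_sub_le {L : ℝ≥0} (hL : ∀ s, LipschitzOnWith L (fun θ => P.Fs θ s) P.Θ)
    {N : ℕ} (z : Fin N → Fin n) {x y : EuclideanSpace ℝ (Fin q)} (hx : x ∈ P.Θ) (hy : y ∈ P.Θ) :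
    P.F y - P.FN z y - (P.F x - P.FN z x) ≤ totalDev z * (L * ‖y - x‖) := by
  rw [F_sub_FN, F_sub_FN, sampleDev_sub]
  exact sampleDev_le_totalDev_mul z fun s => (hL s).norm_sub_le hy hx

theorem mul_meanSqResidual_le [NeZero K] [CompactSpace P.Θ]
    (hφ : ∀ s, LocallyLipschitz (P.φ s)) (hF : P.IsConvexMajorantFamily Fhat) {ε ρ : ℝ}
    (hε : 0 ≤ ε) (x : P.Θ) :
    ρ / 2 * P.meanSqResidual Fhat ε ρ x ≤ P.F x - sInf (P.F '' P.Θ) := by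
  rw [meanSqResidual, Finset.mul_expect]
  refine Finset.expect_le (P.activeMaps_nonempty x hε) fun J _ => ?_
  rw [proxMap]
  split_ifs with hle
  · have hle_prox := sInf_image_F_le hφ (hF.prox_mem J ρ x)
    have hmaj := hF.F_le_avg J x.2 (hF.prox_mem J ρ x)
    rw [proxObj] at hle
    rw [norm_sub_rev]
    linarith
  · simpa using sInf_image_F_le hφ x.2

end ERMProblem

namespace SMMRun

variable {n d K q : ℕ} {P : ERMProblem n d K q} {Fhat : SurrogateFamily n d K q} {ε η : ℝ}
  {N : ℕ → ℕ} {T : ℕ} {θ₀ : EuclideanSpace ℝ (Fin q)} {Ω : Type*} [MeasurableSpace Ω]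
  {μ : Measure Ω} {R : SMMRun P Fhat ε η N T θ₀ μ} {ρ X Y : ℝ}

/-- The convergence rate in expectation of the residual of the output, where `X` stands for the
accumulated effect of the sampling errors. -/
def HasRate (R : SMMRun P Fhat ε η N T θ₀ μ) (ρ X : ℝ) : Prop :=
  Integrable (fun ω => P.rbar Fhat ε ρ (R.output ω)) μ ∧
    (∫ ω, P.rbar Fhat ε ρ (R.output ω) ∂μ) ^ 2 ≤
      (P.F θ₀ - sInf (P.F '' P.Θ) + X) / ((ρ - η) / 2 * T)

theorem HasRate.mono (h : R.HasRate ρ X) (hρ : η ≤ ρ) (hXY : X ≤ Y) : R.HasRate ρ Y :=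
  ⟨h.1, h.2.trans (div_le_div_of_nonneg_right (by linarith)
    (mul_nonneg (by linarith) (Nat.cast_nonneg T)))⟩

variable [IsProbabilityMeasure μ] [NeZero n] [CompactSpace P.Θ]

theorem hasRate_of_sum_integral_le (h₀ : θ₀ ∈ P.Θ) (hφ : ∀ s, LocallyLipschitz (P.φ s))
    (hF : P.IsConvexMajorantFamily Fhat) (hρ : 0 < ρ) (hηρ : η < ρ) (hT : 0 < T)
    (h : (ρ - η) / 2 *
        ∑ ν ∈ Finset.range T, ∫ x : P.Θ, P.meanSqResidual Fhat ε ρ x ∂(R.law h₀ ν) ≤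
      P.F θ₀ - sInf (P.F '' P.Θ) + X) : R.HasRate ρ X := by
  have hrbar := R.integrable_output h₀ fun _ => hF.integrable_rbar hφ hρ ε
  have hres (ν : ℕ) := hF.integrable_meanSqResidual hφ hρ ε (m := R.law h₀ ν)
  unfold HasRate
  simp only [R.output_eq_iterate h₀]
  refine ⟨hrbar, (sq_integral_le hrbar (R.integrable_output h₀ hres)
    fun ω => P.rbar_sq_le_meanSqResidual ε ρ _).trans ?_⟩
  have : (0 : ℝ) < T := Nat.cast_pos.2 hT
  rw [R.integral_output h₀ hres, Fintype.expect_eq_sum_div_card, Fintype.card_fin,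
    Fin.sum_univ_eq_sum_range fun ν => ∫ x : P.Θ, P.meanSqResidual Fhat ε ρ x ∂(R.law h₀ ν),
    ← mul_div_mul_left _ _ (half_pos (sub_pos.2 hηρ)).ne']
  gcongr

variable [NeZero K]

theorem hasRate_sum_expect (h₀ : θ₀ ∈ P.Θ) (hφ : ∀ s, LocallyLipschitz (P.φ s))
    (hF : P.IsConvexMajorantFamily Fhat) (hε : 0 ≤ ε) (hρ : 0 < ρ) (hηρ : η < ρ)
    (hT : 0 < T) (hN : ∀ ν, 1 ≤ N ν) {e : (ν : ℕ) → (Fin (N ν) → Fin n) → ℝ}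
    (he : ∀ ν z, ∀ x ∈ P.Θ, ∀ y ∈ P.Θ,
      P.F y - P.FN z y - (P.F x - P.FN z x) ≤ e ν z + η / 2 * ‖y - x‖ ^ 2) :
    R.HasRate ρ (∑ ν ∈ Finset.range T, 𝔼 z, e ν z) :=
  hasRate_of_sum_integral_le h₀ hφ hF hρ hηρ hT
    (R.sum_integral_meanSqResidual_le h₀ hφ hF hε hρ hN he)

theorem hasRate_zero_of_one_iteration {R : SMMRun P Fhat ε η N 1 θ₀ μ} (h₀ : θ₀ ∈ P.Θ)
    (hφ : ∀ s, LocallyLipschitz (P.φ s)) (hF : P.IsConvexMajorantFamily Fhat) (hε : 0 ≤ ε)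
    (hη : 0 ≤ η) (hηρ : η < ρ) : R.HasRate ρ 0 := by
  refine hasRate_of_sum_integral_le h₀ hφ hF (hη.trans_lt hηρ) hηρ one_pos ?_
  rw [Finset.sum_range_one, R.integral_law_zero h₀ (P.meanSqResidual Fhat ε ρ), add_zero]
  refine le_trans ?_ (ERMProblem.mul_meanSqResidual_le (ρ := ρ) hφ hF hε ⟨θ₀, h₀⟩)
  gcongr
  · exact Finset.expect_nonneg fun J _ => sq_nonneg _
  · linarith

variable {L : ℝ≥0}

theorem hasRate_inv_sqrt (h₀ : θ₀ ∈ P.Θ) (hφ : ∀ s, LocallyLipschitz (P.φ s))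
    (hF : P.IsConvexMajorantFamily Fhat) (hL : ∀ s, LipschitzOnWith L (fun θ => P.Fs θ s) P.Θ)
    (hε : 0 ≤ ε) (hη : 0 ≤ η) (hηρ : η < ρ) (hT : 0 < T) (hN : ∀ ν, 1 ≤ N ν) :
    R.HasRate ρ (√n * (L * Metric.diam P.Θ) * ∑ ν ∈ Finset.range T, 1 / √(N ν)) := by
  have hΘ : IsCompact P.Θ := isCompact_iff_compactSpace.2 inferInstance
  refine (hasRate_sum_expect h₀ hφ hF hε (hη.trans_lt hηρ) hηρ hT hN
    (e := fun _ z => totalDev z * (L * Metric.diam P.Θ)) fun ν z x hx y hy => ?_).mono hηρ.le ?_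
  · calc P.F y - P.FN z y - (P.F x - P.FN z x)
        ≤ totalDev z * (L * ‖y - x‖) := ERMProblem.samplingError_sub_le hL z hx hy
      _ ≤ totalDev z * (L * Metric.diam P.Θ) := by
        gcongr
        · exact totalDev_nonneg z
        · exact dist_eq_norm y x ▸ Metric.dist_le_diam_of_mem hΘ.isBounded hy hx
      _ ≤ _ := le_add_of_nonneg_right (by positivity)
  · rw [Finset.mul_sum]
    refine Finset.sum_le_sum fun ν _ => ?_
    have : NeZero (N ν) := ⟨Nat.one_le_iff_ne_zero.1 (hN ν)⟩
    calc 𝔼 z : Fin (N ν) → Fin n, totalDev z * (L * Metric.diam P.Θ)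
        ≤ √(n / N ν) * (L * Metric.diam P.Θ) := by
          rw [← Finset.expect_mul]
          gcongr
          simpa only [Fintype.card_fin] using expect_totalDev_le (α := Fin n) (ι := Fin (N ν))
      _ = √n * (L * Metric.diam P.Θ) * (1 / √(N ν)) := by
          rw [Real.sqrt_div (Nat.cast_nonneg n)]
          ring

theorem hasRate_inv (h₀ : θ₀ ∈ P.Θ) (hφ : ∀ s, LocallyLipschitz (P.φ s))
    (hF : P.IsConvexMajorantFamily Fhat) (hL : ∀ s, LipschitzOnWith L (fun θ => P.Fs θ s) P.Θ)
    (hε : 0 ≤ ε) (hη : 0 < η) (hηρ : η < ρ) (hT : 0 < T) (hN : ∀ ν, 1 ≤ N ν) :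
    R.HasRate ρ (L ^ 2 * n / (2 * η) * ∑ ν ∈ Finset.range T, 1 / (N ν : ℝ)) := by
  refine (hasRate_sum_expect h₀ hφ hF hε (hη.trans hηρ) hηρ hT hN
    (e := fun _ z => (totalDev z * L) ^ 2 / (2 * η)) fun ν z x hx y hy => ?_).mono hηρ.le ?_
  · calc P.F y - P.FN z y - (P.F x - P.FN z x)
        ≤ totalDev z * L * ‖y - x‖ :=
          (ERMProblem.samplingError_sub_le hL z hx hy).trans_eq (mul_assoc _ _ _).symm
      _ ≤ _ := mul_le_sq_div_add_mul_sq hη _ _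
  · rw [Finset.mul_sum]
    refine Finset.sum_le_sum fun ν _ => ?_
    have : NeZero (N ν) := ⟨Nat.one_le_iff_ne_zero.1 (hN ν)⟩
    calc 𝔼 z : Fin (N ν) → Fin n, (totalDev z * L) ^ 2 / (2 * η)
        = (𝔼 z : Fin (N ν) → Fin n, totalDev z ^ 2) * (L ^ 2 / (2 * η)) := by
          simp only [mul_pow, mul_div_assoc, Finset.expect_mul]
      _ ≤ n / N ν * (L ^ 2 / (2 * η)) := by
          gcongr
          simpa only [Fintype.card_fin] using expect_totalDev_sq_le (α := Fin n) (ι := Fin (N ν))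
      _ = L ^ 2 * n / (2 * η) * (1 / N ν) := by ring

end SMMRun

theorem proposition4_general {n d K q : ℕ} (hn : 0 < n) (hK : 0 < K) (P : ERMProblem n d K q)
    (hφ : ∀ s, LocallyLipschitz (P.φ s)) (hΘ : IsCompact P.Θ) (Fhat : SurrogateFamily n d K q)
    (hF : P.IsConvexMajorantFamily Fhat) :
    (∃ C₁ : ℝ, 0 < C₁ ∧
      ∀ (ε η : ℝ), 0 ≤ ε → 0 ≤ η →
      ∀ (N : ℕ → ℕ), (∀ ν, 2 ≤ N ν) →
      ∀ (T : ℕ), 0 < T → ∀ θ₀ ∈ P.Θ,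
      ∀ (Ω : Type u) [MeasurableSpace Ω] (μ : Measure Ω) [IsProbabilityMeasure μ]
        (R : SMMRun P Fhat ε η N T θ₀ μ) (ρ : ℝ), η < ρ →
        R.HasRate ρ (C₁ * ∑ ν ∈ Finset.range T, √(Real.log (N ν) / N ν))) ∧
    (∀ (N : ℕ → ℕ), StrictMono N → 1 ≤ N 0 →
      ∃ C₁ : ℝ, 0 < C₁ ∧
      ∀ (ε η : ℝ), 0 ≤ ε → 0 ≤ η →
      ∀ (T : ℕ), 0 < T → ∀ θ₀ ∈ P.Θ,
      ∀ (Ω : Type u) [MeasurableSpace Ω] (μ : Measure Ω) [IsProbabilityMeasure μ]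
        (R : SMMRun P Fhat ε η N T θ₀ μ) (ρ : ℝ), η < ρ →
        R.HasRate ρ (C₁ * ∑ ν ∈ Finset.range T, √(Real.log (N ν) / N ν))) ∧
    (∀ (η : ℝ), 0 < η →
      ∃ C₂ : ℝ, 0 < C₂ ∧
      ∀ (ε : ℝ), 0 ≤ ε →
      ∀ (N : ℕ → ℕ), (∀ ν, 1 ≤ N ν) →
      ∀ (T : ℕ), 0 < T → ∀ θ₀ ∈ P.Θ,
      ∀ (Ω : Type u) [MeasurableSpace Ω] (μ : Measure Ω) [IsProbabilityMeasure μ]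
        (R : SMMRun P Fhat ε η N T θ₀ μ) (ρ : ℝ), η < ρ →
        R.HasRate ρ (C₂ * ∑ ν ∈ Finset.range T, 1 / (N ν : ℝ))) := by
  have : NeZero n := ⟨hn.ne'⟩
  have : NeZero K := ⟨hK.ne'⟩
  have : CompactSpace P.Θ := isCompact_iff_compactSpace.1 hΘ
  obtain ⟨L, hL⟩ := ERMProblem.exists_lipschitzOnWith_Fs hφ hΘ
  set c := √n * (L * Metric.diam P.Θ)
  have hscale {a s t : ℝ} (hs : 0 ≤ s) (hst : t ≤ a * s) : c * t ≤ (c * a + 1) * s := by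
    linarith [mul_le_mul_of_nonneg_left hst (show 0 ≤ c by positivity)]
  refine ⟨⟨c * (√(Real.log 2))⁻¹ + 1, by positivity, ?_⟩, fun N hN hN₀ =>
    ⟨c * ((√(Real.log 2))⁻¹ + (√(Real.log (N 1) / N 1))⁻¹) + 1, by positivity, ?_⟩, fun η hη =>
    ⟨L ^ 2 * n / (2 * η) + 1, by positivity, ?_⟩⟩
  · intro ε η hε hη N hN T hT θ₀ h₀ Ω _ μ _ R ρ hρ
    refine (SMMRun.hasRate_inv_sqrt h₀ hφ hF hL hε hη hρ hT
      fun ν => one_le_two.trans (hN ν)).mono hρ.le ?_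
    exact hscale (Finset.sum_nonneg fun _ _ => Real.sqrt_nonneg _)
      (sum_inv_sqrt_le_of_two_le hN T)
  · intro ε η hε hη T hT θ₀ h₀ Ω _ μ _ R ρ hρ
    obtain rfl | hT₁ := (Nat.succ_le_of_lt hT).eq_or_lt
    · exact (SMMRun.hasRate_zero_of_one_iteration h₀ hφ hF hε hη hρ).mono hρ.le (by positivity)
    refine (SMMRun.hasRate_inv_sqrt h₀ hφ hF hL hε hη hρ hT
      fun ν => hN₀.trans (hN.monotone (Nat.zero_le ν))).mono hρ.le ?_
    exact hscale (Finset.sum_nonneg fun _ _ => Real.sqrt_nonneg _)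
      (sum_inv_sqrt_le_of_strictMono hN hN₀ hT₁)
  · intro ε hε N hN T hT θ₀ h₀ Ω _ μ _ R ρ hρ
    refine (SMMRun.hasRate_inv h₀ hφ hF hL hε hη hρ hT hN).mono hρ.le ?_
    gcongr
    exact le_add_of_nonneg_right zero_le_one

theorem proposition4 {n d K q : ℕ} (hn : 0 < n) (hK : 0 < K)
    (P : ERMProblem n d K q) (hφ : ∀ s : Fin n, BDifferentiable (P.φ s))
    (hΘ : IsCompact P.Θ) (hΘc : Convex ℝ P.Θ)
    (Fhat : SurrogateFamily n d K q) (hF : P.IsSurrogateFamily Fhat) :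
    -- general rate: one constant for all sequences with `N ν ≥ 2`
    (∃ C₁ : ℝ, 0 < C₁ ∧
      ∀ (ε η : ℝ), 0 ≤ ε → 0 ≤ η →
      ∀ (N : ℕ → ℕ), (∀ ν, 2 ≤ N ν) →
      ∀ (T : ℕ), 0 < T → ∀ θ₀ ∈ P.Θ,
      ∀ (Ω : Type u) [MeasurableSpace Ω] (μ : Measure Ω) [IsProbabilityMeasure μ]
        (R : SMMRun P Fhat ε η N T θ₀ μ) (ρ : ℝ), η < ρ →
        Integrable (fun ω => P.rbar Fhat ε ρ (R.output ω)) μ ∧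
        (∫ ω, P.rbar Fhat ε ρ (R.output ω) ∂μ) ^ 2 ≤
          (P.F θ₀ - sInf (P.F '' P.Θ)
              + C₁ * ∑ ν ∈ Finset.range T, Real.sqrt (Real.log (N ν) / (N ν)))
            / ((ρ - η) / 2 * T)) ∧
    -- general rate: a strictly increasing sequence that may start with `N 0 = 1`
    (∀ (N : ℕ → ℕ), StrictMono N → 1 ≤ N 0 →
      ∃ C₁ : ℝ, 0 < C₁ ∧
      ∀ (ε η : ℝ), 0 ≤ ε → 0 ≤ η →
      ∀ (T : ℕ), 0 < T → ∀ θ₀ ∈ P.Θ,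
      ∀ (Ω : Type u) [MeasurableSpace Ω] (μ : Measure Ω) [IsProbabilityMeasure μ]
        (R : SMMRun P Fhat ε η N T θ₀ μ) (ρ : ℝ), η < ρ →
        Integrable (fun ω => P.rbar Fhat ε ρ (R.output ω)) μ ∧
        (∫ ω, P.rbar Fhat ε ρ (R.output ω) ∂μ) ^ 2 ≤
          (P.F θ₀ - sInf (P.F '' P.Θ)
              + C₁ * ∑ ν ∈ Finset.range T, Real.sqrt (Real.log (N ν) / (N ν)))
            / ((ρ - η) / 2 * T)) ∧
    -- faster rate for `ε = 0` and `η > 0`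
    (∀ (η : ℝ), 0 < η →
      ∃ C₂ : ℝ, 0 < C₂ ∧
      ∀ (N : ℕ → ℕ), (∀ ν, 1 ≤ N ν) →
      ∀ (T : ℕ), 0 < T → ∀ θ₀ ∈ P.Θ,
      ∀ (Ω : Type u) [MeasurableSpace Ω] (μ : Measure Ω) [IsProbabilityMeasure μ]
        (R : SMMRun P Fhat 0 η N T θ₀ μ) (ρ : ℝ), η < ρ →
        Integrable (fun ω => P.rbar Fhat 0 ρ (R.output ω)) μ ∧
        (∫ ω, P.rbar Fhat 0 ρ (R.output ω) ∂μ) ^ 2 ≤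
          (P.F θ₀ - sInf (P.F '' P.Θ)
              + C₂ * ∑ ν ∈ Finset.range T, 1 / (N ν : ℝ))
            / ((ρ - η) / 2 * T)) := by
  obtain ⟨h₁, h₂, h₃⟩ :=
    proposition4_general hn hK P (fun s => (hφ s).1) hΘ Fhat hF.isConvexMajorantFamily
  exact ⟨h₁, h₂, fun η hη => (h₃ η hη).imp fun _ h => ⟨h.1, h.2 0 le_rfl⟩⟩
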